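/- **Theorem 1.1.** Let $\mu>0$, $\lambda\in\mathbb{R}$ with $2\mu+\lambda>0$, $A>0$ and $\gamma>1$, and consider the Cauchy problem for the one-dimensional isentropic compressible Navier–Stokes equations $$\rho_t+(\rho u)_x=0,\qquad (\rho u)_t+(\rho u^2)_x+p_x=(2\mu+\lambda)\,u_{xx},\qquad p=A\rho^\gamma,\qquad x\in\mathbb{R},$$ with continuous initial data $(\rho,u)|_{t=0}=(\rho_0,u_0)$ on $\mathbb{R}$ such that $$\operatorname{supp}\rho_0=[0,1],\qquad \rho_0(x)>0\ \text{ for } x\in(0,1).$$ Suppose that at least one of the following two conditions holds: 1. there are $\lambda_1>0$ and $\lambda_3\in(0,1)$ with $\dfrac{(\rho_0)_x}{\rho_0}\ge\lambda_1$ and $u_0\le 0$ in $(0,\lambda_3)$, and $u_0(\lambda_3)<0$; 2. there are $\lambda_2>0$ and $\lambda_4\in(0,1)$ with $\dfrac{(\rho_0)_x}{\rho_0}\le-\lambda_2$ and $u_0\ge 0$ in $(\lambda_4,1)$, and $u_0(\lambda_4)>0$. Then for every real $m>2$ and every $T>0$ the Cauchy problem has no solution $(\rho,u)$ with $\rho,u\in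 C^1([0,T];H^m(\mathbb{R}))$. (Here the equations are only required to hold in the sense of distributions in $x$ at each time $t\in(0,T)$, so that in particular there is no classical solution in this class.) -/

import Mathlib

open MeasureTheory Set
open scoped SchwartzMap ContDiff

noncomputable section

namespace IsentropicNS

/-- `g` is the Bessel potential of order `s` of the real function `f ∈ L²(ℝ)`, i.e.
`𝓕 g = (1 + |ξ|²)^(s/2) 𝓕 f` with `g ∈ L²(ℝ)`. For `s ≥ 0`, the Sobolev space `H^s(ℝ)` consists of
the (a.e. classes of) functions `f` that have such a `g`, and `‖f‖_{H^s} = ‖g‖_{L²}`. -/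
def HasBesselPotential (s : ℝ) (f : ℝ → ℝ) (g : Lp ℂ 2 (volume : Measure ℝ)) : Prop :=
  ∃ F : Lp ℂ 2 (volume : Measure ℝ), (∀ᵐ x, F x = (f x : ℂ)) ∧
    TemperedDistribution.besselPotential ℝ ℂ s (F : 𝓢'(ℝ, ℂ)) = (g : 𝓢'(ℝ, ℂ))

/-- `f ∈ C¹([0,T]; H^s(ℝ))` for `s ≥ 0`, where `f t x` is the value at time `t` and position `x`.
The Bessel potential of order `s` is an isometry of `H^s(ℝ)` into `L²(ℝ)`, so the curve
`t ↦ f t` is continuously differentiable in the norm of `H^s(ℝ)` if and only if the curve of its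
Bessel potentials is continuously differentiable in `L²(ℝ)` (one-sided at the end points). -/
def MemC1Sobolev (T s : ℝ) (f : ℝ → ℝ → ℝ) : Prop :=
  ∃ g : ℝ → Lp ℂ 2 (volume : Measure ℝ), ContDiffOn ℝ 1 g (Icc 0 T) ∧
    ∀ t ∈ Icc 0 T, HasBesselPotential s (f t) (g t)

/-- The equation of state `p = A ρ^γ`. -/
def pressure (A γ r : ℝ) : ℝ := A * r ^ γ

/-- `(ρ, u)` solves on `[0,T]` the Cauchy problem for the one-dimensional isentropic compressible
Navier–Stokes equations with viscosity coefficients `μ`, `lam` and pressure `p = A ρ^γ`,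
`ρ_t + (ρ u)_x = 0`, `(ρ u)_t + (ρ u²)_x + p_x = μ u_xx + (μ + lam) u_xx`,
and belongs to `C¹([0,T]; H^m(ℝ))`. At each time `t ∈ (0,T)` the equations hold in the sense of
distributions in `x`; in particular, classical (pointwise) solutions in this class are included. -/
structure IsSolution (μ lam A γ m T : ℝ) (ρ₀ u₀ : ℝ → ℝ) (ρ u : ℝ → ℝ → ℝ) : Prop where
  density_mem : MemC1Sobolev T m ρ
  velocity_mem : MemC1Sobolev T m u
  continuity_eq : ∀ φ : ℝ → ℝ, ContDiff ℝ ∞ φ → HasCompactSupport φ → ∀ t ∈ Ioo 0 T,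
    HasDerivAt (fun s => ∫ x, ρ s x * φ x) (∫ x, ρ t x * u t x * deriv φ x) t
  momentum_eq : ∀ φ : ℝ → ℝ, ContDiff ℝ ∞ φ → HasCompactSupport φ → ∀ t ∈ Ioo 0 T,
    HasDerivAt (fun s => ∫ x, ρ s x * u s x * φ x)
      ((∫ x, (ρ t x * u t x ^ 2 + pressure A γ (ρ t x)) * deriv φ x)
        + (μ + (μ + lam)) * ∫ x, u t x * deriv (deriv φ) x) t
  density_init : ∀ᵐ x, ρ 0 x = ρ₀ x
  velocity_init : ∀ᵐ x, u 0 x = u₀ x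

/-- The condition on the initial data near the left end point of `(0,1)`. -/
def LeftCondition (ρ₀ u₀ : ℝ → ℝ) : Prop :=
  ∃ l₁ l₃ : ℝ, 0 < l₁ ∧ 0 < l₃ ∧ l₃ < 1 ∧
    (∀ x ∈ Ioo 0 l₃, l₁ ≤ deriv ρ₀ x / ρ₀ x) ∧
    u₀ l₃ < 0 ∧ ∀ x ∈ Ioo 0 l₃, u₀ x ≤ 0

/-- The condition on the initial data near the right end point of `(0,1)`. -/
def RightCondition (ρ₀ u₀ : ℝ → ℝ) : Prop :=
  ∃ l₂ l₄ : ℝ, 0 < l₂ ∧ 0 < l₄ ∧ l₄ < 1 ∧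
    (∀ x ∈ Ioo l₄ 1, deriv ρ₀ x / ρ₀ x ≤ -l₂) ∧
    0 < u₀ l₄ ∧ ∀ x ∈ Ioo l₄ 1, 0 ≤ u₀ x

end IsentropicNS

end

/-!
By the Sobolev embedding a solution has a representative with `u` and `u_x` bounded and Lipschitz
that solves the equations pointwise. In the vacuum the momentum equation reduces to `u_xx = 0`, and
`u` vanishes at infinity, so `u = 0` on the vacuum side of the interface: the interface does not
move, and `u = u_x = 0` there. For a short time the lower bound on `(log ρ)_x` survives along
trajectories up to the bounded contribution of `u_xx`, hence `p_x ≥ 0` next to the interface and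
`u` is a nonpositive subsolution of a parabolic equation. Comparison with an exponential barrier, as
in the Hopf lemma, gives `u_x < 0` at the interface, a contradiction.
-/

open Filter Topology FourierTransform BoundedContinuousFunction NNReal

namespace IsentropicNS

noncomputable section

section SobolevEmbedding

/-- The symbol `(1 + |ξ|²)^(-s/2)` of the Bessel potential of order `-s`. -/
def besselSymbol (s : ℝ) (ξ : ℝ) : ℂ := ((1 + ‖ξ‖ ^ 2) ^ (-s / 2) : ℝ)

/-- The operator `g ↦ 𝓕⁻¹ (a · 𝓕 g)` from `L²` to bounded continuous functions, for `a ∈ L²`. -/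
def fourierMultiplierL2 (a : Lp ℂ 2 (volume : Measure ℝ)) :
    Lp ℂ 2 (volume : Measure ℝ) →L[ℂ] (ℝ →ᵇ ℂ) :=
  (Real.Lp.fourierTransformInvCLM (V := ℝ) (E := ℂ)) ∘L
    ((ContinuousLinearMap.mul ℂ ℂ).holderL volume 2 2 1 a) ∘L
    ((Lp.fourierTransformₗᵢ ℝ ℂ).toContinuousLinearEquiv :
      Lp ℂ 2 (volume : Measure ℝ) →L[ℂ] Lp ℂ 2 (volume : Measure ℝ))

lemma fourierMultiplierL2_apply {k : ℝ → ℂ} (hk : MemLp k 2)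
    (g : Lp ℂ 2 (volume : Measure ℝ)) (x : ℝ) :
    fourierMultiplierL2 (hk.toLp k) g x =
      𝓕⁻ (fun ξ => k ξ * (𝓕 g : Lp ℂ 2 (volume : Measure ℝ)) ξ) x := by
  have eq_holder : fourierMultiplierL2 (hk.toLp k) g x =
      𝓕⁻ (((ContinuousLinearMap.mul ℂ ℂ).holder 1 (hk.toLp k)
        (𝓕 g : Lp ℂ 2 (volume : Measure ℝ)) : Lp ℂ 1 (volume : Measure ℝ)) : ℝ → ℂ) x :=
    Real.Lp.fourierTransformInv_apply _ x
  rw [eq_holder]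
  apply Real.fourierInv_congr_ae
  filter_upwards [(ContinuousLinearMap.mul ℂ ℂ).coeFn_holder (r := 1) (hk.toLp k)
    (𝓕 g : Lp ℂ 2 (volume : Measure ℝ)), hk.coeFn_toLp] with ξ holder_eq toLp_eq
  rw [holder_eq, toLp_eq, ContinuousLinearMap.mul_apply']

lemma fourierInv_eq_fourier_comp_neg (f : ℝ → ℂ) : 𝓕⁻ f = 𝓕 f ∘ Neg.neg :=
  funext (Real.fourierInv_eq_fourier_neg f)

lemma hasDerivAt_fourierInv {f : ℝ → ℂ} (hf : Integrable f)
    (hf' : Integrable (fun x : ℝ => x • f x)) (w : ℝ) :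
    HasDerivAt (𝓕⁻ f) (𝓕⁻ (fun x : ℝ => (2 * Real.pi * Complex.I * x) * f x) w) w := by
  rw [fourierInv_eq_fourier_comp_neg]
  convert! (Real.hasDerivAt_fourier hf hf' (-w)).scomp w (hasDerivAt_neg w) using 1
  rw [Real.fourierInv_eq_fourier_neg, Real.fourier_eq, Real.fourier_eq, ← integral_smul]
  congr 1
  ext v
  simp only [smul_eq_mul, neg_smul, one_smul, Circle.smul_def]
  ring

lemma tendsto_fourierInv_cocompact (f : ℝ → ℂ) : Tendsto (𝓕⁻ f) (cocompact ℝ) (𝓝 0) := by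
  rw [fourierInv_eq_fourier_comp_neg]
  exact (Real.zero_at_infty_fourier f).comp (Homeomorph.neg ℝ).isClosedEmbedding.tendsto_cocompact

lemma hasTemperateGrowth_besselSymbol (s : ℝ) : (besselSymbol s).HasTemperateGrowth := by
  unfold besselSymbol
  fun_prop

lemma norm_besselSymbol (s ξ : ℝ) : ‖besselSymbol s ξ‖ = (1 + ‖ξ‖ ^ 2) ^ (-s / 2) := by
  rw [besselSymbol, Complex.norm_real, Real.norm_of_nonneg (by positivity)]

lemma memLp_besselSymbol {s : ℝ} (hs : 1 / 2 < s) : MemLp (besselSymbol s) 2 := by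
  rw [memLp_two_iff_integrable_sq_norm
    (hasTemperateGrowth_besselSymbol s).1.continuous.aestronglyMeasurable]
  refine (integrable_rpow_neg_one_add_norm_sq (E := ℝ) (r := 2 * s) ?_).congr ?_
  · rw [Module.finrank_self]
    push_cast
    linarith
  · filter_upwards with ξ
    rw [norm_besselSymbol, ← Real.rpow_mul_natCast (by positivity)]
    congr 1
    push_cast
    ring

lemma norm_mul_norm_besselSymbol_le (s ξ : ℝ) :
    ‖ξ‖ * ‖besselSymbol s ξ‖ ≤ ‖besselSymbol (s - 1) ξ‖ := by
  have norm_le : ‖ξ‖ ≤ (1 + ‖ξ‖ ^ 2) ^ (1 / 2 : ℝ) := by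
    rw [← Real.sqrt_eq_rpow]
    exact Real.le_sqrt_of_sq_le (by linarith)
  calc ‖ξ‖ * ‖besselSymbol s ξ‖
      ≤ (1 + ‖ξ‖ ^ 2) ^ (1 / 2 : ℝ) * (1 + ‖ξ‖ ^ 2) ^ (-s / 2) := by
        rw [norm_besselSymbol]
        gcongr
    _ = ‖besselSymbol (s - 1) ξ‖ := by
        rw [norm_besselSymbol, ← Real.rpow_add (by positivity)]
        congr 1
        ring

lemma memLp_mul_besselSymbol {s : ℝ} (hs : 3 / 2 < s) :
    MemLp (fun ξ : ℝ => (2 * Real.pi * Complex.I * ξ) * besselSymbol s ξ) 2 := by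
  have symbol_continuous := (hasTemperateGrowth_besselSymbol s).1.continuous
  refine (memLp_besselSymbol (s := s - 1) (by linarith)).of_le_mul (c := 2 * Real.pi)
    (by fun_prop) (Eventually.of_forall fun ξ => ?_)
  rw [norm_mul, norm_mul, norm_mul, norm_mul, Complex.norm_I, Complex.norm_ofNat, Complex.norm_real,
    Complex.norm_real, Real.norm_of_nonneg Real.pi_pos.le, mul_one, mul_assoc]
  gcongr
  exact norm_mul_norm_besselSymbol_le s ξ

lemma integrable_smul_besselSymbol_mul {s : ℝ} (hs : 3 / 2 < s) {G : ℝ → ℂ} (hG : MemLp G 2) :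
    Integrable (fun ξ : ℝ => ξ • (besselSymbol s ξ * G ξ)) := by
  refine (((memLp_mul_besselSymbol hs).integrable_mul hG).const_mul
    (2 * Real.pi * Complex.I)⁻¹).congr (Eventually.of_forall fun ξ => ?_)
  have pi_ne_zero : (Real.pi : ℂ) ≠ 0 := mod_cast Real.pi_ne_zero
  simp only [Pi.mul_apply, Complex.real_smul]
  field_simp [Complex.I_ne_zero]

lemma integral_fourierInv_schwartz_smul (φ : 𝓢(ℝ, ℂ)) {f : ℝ → ℂ} (hf : Integrable f) :
    ∫ ξ, (𝓕⁻ φ) ξ • f ξ = ∫ x, φ x • 𝓕⁻ f x := by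
  have pairing_continuous :
      Continuous fun p : ℝ × ℝ => (-innerₗ ℝ : ℝ →ₗ[ℝ] ℝ →ₗ[ℝ] ℝ) p.1 p.2 := by
    simp only [LinearMap.neg_apply, innerₗ_apply_apply]
    fun_prop
  have pairing_flip : (-innerₗ ℝ : ℝ →ₗ[ℝ] ℝ →ₗ[ℝ] ℝ).flip = -innerₗ ℝ := by
    ext
    simp
  have self_adjoint := VectorFourier.integral_fourierIntegral_smul_eq_flip (μ := volume)
    (ν := volume) Real.continuous_fourierChar pairing_continuous φ.integrable hf
  rw [pairing_flip] at self_adjoint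
  rw [SchwartzMap.fourierInv_coe]
  exact self_adjoint

lemma integral_smul_eq_of_besselPotential_eq {s : ℝ} (hs : 1 / 2 < s)
    {F g : Lp ℂ 2 (volume : Measure ℝ)}
    (h : TemperedDistribution.besselPotential ℝ ℂ s (F : 𝓢'(ℝ, ℂ)) = (g : 𝓢'(ℝ, ℂ)))
    (φ : 𝓢(ℝ, ℂ)) :
    ∫ x, φ x • F x =
      ∫ x, φ x • fourierMultiplierL2 ((memLp_besselSymbol hs).toLp _) g x := by
  set ghat : Lp ℂ 2 (volume : Measure ℝ) := 𝓕 g with ghat_def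
  have eq_multiplier : (F : 𝓢'(ℝ, ℂ)) =
      𝓕⁻ (TemperedDistribution.smulLeftCLM ℂ (besselSymbol s) (ghat : 𝓢'(ℝ, ℂ))) := by
    rw [← (TemperedDistribution.besselPotential_neg_apply_eq_iff s _ _).2 h, ghat_def,
      ← Lp.fourier_toTemperedDistribution_eq]
    exact TemperedDistribution.fourierMultiplierCLM_apply _ _
  calc ∫ x, φ x • F x
      = (F : 𝓢'(ℝ, ℂ)) φ := (Lp.toTemperedDistribution_apply F φ).symm
    _ = ∫ ξ, (𝓕⁻ φ) ξ • (besselSymbol s ξ * ghat ξ) := by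
        rw [eq_multiplier, TemperedDistribution.fourierInv_apply,
          TemperedDistribution.smulLeftCLM_apply_apply, Lp.toTemperedDistribution_apply]
        congr 1
        ext ξ
        rw [SchwartzMap.smulLeftCLM_apply_apply (hasTemperateGrowth_besselSymbol s)]
        simp only [smul_eq_mul]
        ring
    _ = ∫ x, φ x • 𝓕⁻ (fun ξ => besselSymbol s ξ * ghat ξ) x :=
        integral_fourierInv_schwartz_smul φ
          ((memLp_besselSymbol hs).integrable_mul (Lp.memLp ghat))
    _ = _ := by simp only [fourierMultiplierL2_apply, ghat_def]

lemma HasBesselPotential.ae_eq_fourierMultiplierL2 {s : ℝ} (hs : 1 / 2 < s) {f : ℝ → ℝ}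
    {g : Lp ℂ 2 (volume : Measure ℝ)} (h : HasBesselPotential s f g) :
    ∀ᵐ x, (f x : ℂ) = fourierMultiplierL2 ((memLp_besselSymbol hs).toLp _) g x := by
  obtain ⟨F, F_eq, potential_eq⟩ := h
  have ae_eq : ∀ᵐ x, F x = fourierMultiplierL2 ((memLp_besselSymbol hs).toLp _) g x := by
    refine ae_eq_of_integral_contDiff_smul_eq ((Lp.memLp F).locallyIntegrable (by norm_num))
      (map_continuous _).locallyIntegrable fun φ φ_smooth φ_compact => ?_
    have ofReal_compact : HasCompactSupport (Complex.ofRealCLM ∘ φ) := φ_compact.comp_left rfl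
    have ofReal_smooth : ContDiff ℝ ∞ (Complex.ofRealCLM ∘ φ) := by fun_prop
    simpa using integral_smul_eq_of_besselPotential_eq hs potential_eq
      (ofReal_compact.toSchwartzMap ofReal_smooth)
  filter_upwards [F_eq, ae_eq] with x eq_ofReal eq_multiplier
  rw [← eq_ofReal, eq_multiplier]

/-- `F` is a curve of bounded continuous representatives of the functions `f t`, `t ∈ [0,T]`, which
vanish at infinity and have the spatial derivatives `Fx`; both `F` and `Fx` are continuously
differentiable in time with respect to the supremum norm. -/
structure IsC1Representative (T : ℝ) (f : ℝ → ℝ → ℝ) (F Fx : ℝ → ℝ →ᵇ ℝ) : Prop where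
  contDiffOn : ContDiffOn ℝ 1 F (Icc 0 T)
  contDiffOn_gradient : ContDiffOn ℝ 1 Fx (Icc 0 T)
  ae_eq : ∀ t ∈ Icc 0 T, f t =ᵐ[volume] F t
  hasDerivAt : ∀ t ∈ Icc 0 T, ∀ x, HasDerivAt (F t) (Fx t x) x
  tendsto_cocompact : ∀ t ∈ Icc 0 T, Tendsto (F t) (cocompact ℝ) (𝓝 0)

theorem MemC1Sobolev.exists_isC1Representative {T s : ℝ} (hs : 3 / 2 < s) {f : ℝ → ℝ → ℝ}
    (hf : MemC1Sobolev T s f) : ∃ F Fx, IsC1Representative T f F Fx := by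
  obtain ⟨g, g_contDiffOn, potential⟩ := hf
  have half_lt : 1 / 2 < s := by linarith
  let realMultiplier (a : Lp ℂ 2 (volume : Measure ℝ)) :
      Lp ℂ 2 (volume : Measure ℝ) →L[ℝ] (ℝ →ᵇ ℝ) :=
    Complex.reCLM.compLeftContinuousBounded ℝ ∘L (fourierMultiplierL2 a).restrictScalars ℝ
  have realMultiplier_apply {k : ℝ → ℂ} (hk : MemLp k 2) (t x : ℝ) :
      realMultiplier (hk.toLp k) (g t) x =
        (𝓕⁻ (fun ξ => k ξ * (𝓕 (g t) : Lp ℂ 2 (volume : Measure ℝ)) ξ) x).re := by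
    rw [← fourierMultiplierL2_apply hk]
    rfl
  refine ⟨fun t => realMultiplier ((memLp_besselSymbol half_lt).toLp _) (g t),
    fun t => realMultiplier ((memLp_mul_besselSymbol hs).toLp _) (g t),
    (realMultiplier _).contDiff.comp_contDiffOn g_contDiffOn,
    (realMultiplier _).contDiff.comp_contDiffOn g_contDiffOn,
    fun t ht => ?_, fun t _ x => ?_, fun t _ => ?_⟩
  · filter_upwards [(potential t ht).ae_eq_fourierMultiplierL2 half_lt] with x hx
    exact (congrArg Complex.re hx :)
  · simp only [funext (realMultiplier_apply _ t), mul_assoc _ (besselSymbol s _)]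
    exact Complex.reCLM.hasFDerivAt.comp_hasDerivAt x (hasDerivAt_fourierInv
      ((memLp_besselSymbol half_lt).integrable_mul (Lp.memLp (𝓕 (g t))))
      (integrable_smul_besselSymbol_mul hs (Lp.memLp (𝓕 (g t)))) x)
  · simp only [funext (realMultiplier_apply _ t)]
    simpa only [Complex.zero_re, Function.comp_def] using
      (Complex.continuous_re.tendsto 0).comp (tendsto_fourierInv_cocompact _)

end SobolevEmbedding

section Calculus

lemma norm_le_exp_mul_norm_left {E : Type*} [NormedAddCommGroup E] [NormedSpace ℝ E] {a b K : ℝ}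
    {f f' : ℝ → E} (hab : a ≤ b) (hc : ContinuousOn f (Icc a b))
    (hd : ∀ t ∈ Ioo a b, HasDerivAt f (f' t) t) (hb : ∀ t ∈ Ioo a b, ‖f' t‖ ≤ K * ‖f t‖) :
    ‖f b‖ ≤ Real.exp (K * (b - a)) * ‖f a‖ := by
  rcases hab.eq_or_lt with rfl | hab
  · simp
  have bound_from_interior : ∀ᶠ t in 𝓝[>] a, ‖f b‖ ≤ Real.exp (K * (b - t)) * ‖f t‖ := by
    filter_upwards [Ioo_mem_nhdsGT hab] with t ht
    have ode_bound := norm_le_gronwallBound_of_norm_deriv_right_le (δ := ‖f t‖) (ε := 0) (K := K)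
      (hc.mono (Icc_subset_Icc_left ht.1.le))
      (fun x hx => (hd x ⟨ht.1.trans_le hx.1, hx.2⟩).hasDerivWithinAt) le_rfl
      (fun x hx => by simpa using hb x ⟨ht.1.trans_le hx.1, hx.2⟩) b ⟨ht.2.le, le_rfl⟩
    rwa [gronwallBound_ε0, mul_comm] at ode_bound
  have tendsto_exp : Tendsto (fun t => Real.exp (K * (b - t))) (𝓝[>] a)
      (𝓝 (Real.exp (K * (b - a)))) := Continuous.continuousWithinAt (by fun_prop)
  refine ge_of_tendsto (tendsto_exp.mul (Tendsto.norm ?_)) bound_from_interior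
  rw [← nhdsWithin_Ioo_eq_nhdsGT hab]
  exact (hc a (left_mem_Icc.2 hab.le)).tendsto.mono_left (nhdsWithin_mono a Ioo_subset_Icc_self)

lemma norm_le_exp_mul_norm {E : Type*} [NormedAddCommGroup E] [NormedSpace ℝ E] {a b K : ℝ}
    {f f' : ℝ → E} (hc : ContinuousOn f (Icc a b)) (hd : ∀ t ∈ Ioo a b, HasDerivAt f (f' t) t)
    (hb : ∀ t ∈ Ioo a b, ‖f' t‖ ≤ K * ‖f t‖) {r s : ℝ} (hr : r ∈ Icc a b) (hs : s ∈ Icc a b) :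
    ‖f s‖ ≤ Real.exp (K * |s - r|) * ‖f r‖ := by
  rcases le_total r s with hrs | hsr
  · rw [abs_of_nonneg (sub_nonneg.2 hrs)]
    have sub : Ioo r s ⊆ Ioo a b := Ioo_subset_Ioo hr.1 hs.2
    exact norm_le_exp_mul_norm_left hrs (hc.mono (Icc_subset_Icc hr.1 hs.2))
      (fun t ht => hd t (sub ht)) (fun t ht => hb t (sub ht))
  · have neg_mem {t : ℝ} (ht : t ∈ Ioo (-r) (-s)) : -t ∈ Ioo a b :=
      ⟨by linarith [ht.2, hs.1], by linarith [ht.1, hr.2]⟩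
    have reversed := norm_le_exp_mul_norm_left (f := fun t => f (-t)) (f' := fun t => -f' (-t))
      (K := K) (neg_le_neg hsr)
      (hc.comp (by fun_prop) fun t ht => ⟨by linarith [ht.2, hs.1], by linarith [ht.1, hr.2]⟩)
      (fun t ht => by
        simpa [Function.comp_def] using (hd (-t) (neg_mem ht)).scomp t (hasDerivAt_neg t))
      (fun t ht => by simpa using hb (-t) (neg_mem ht))
    rwa [neg_neg, neg_neg, neg_sub_neg, ← abs_of_nonneg (sub_nonneg.2 hsr), abs_sub_comm]
      at reversed

lemma pos_of_abs_deriv_le {a b K : ℝ} {f f' : ℝ → ℝ} (hc : ContinuousOn f (Icc a b))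
    (hd : ∀ t ∈ Ioo a b, HasDerivAt f (f' t) t) (hb : ∀ t ∈ Ioo a b, |f' t| ≤ K * |f t|)
    {r s : ℝ} (hr : r ∈ Icc a b) (hs : s ∈ Icc a b) (hpos : 0 < f r) : 0 < f s := by
  by_contra! hle
  obtain ⟨z, hz, f_z⟩ := isPreconnected_Icc.intermediate_value hs hr hc ⟨hle, hpos.le⟩
  have norm_le := norm_le_exp_mul_norm hc hd hb hz hr
  rw [f_z, norm_zero, mul_zero, norm_le_zero_iff] at norm_le
  exact hpos.ne' norm_le

lemma eq_of_hasDerivAt_zero_Ioo {f : ℝ → ℝ} {a b : ℝ} (hc : ContinuousOn f (Icc a b))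
    (hd : ∀ t ∈ Ioo a b, HasDerivAt f 0 t) {r s : ℝ} (hr : r ∈ Icc a b) (hs : s ∈ Icc a b) :
    f s = f r := by
  have norm_le := norm_le_exp_mul_norm (K := 0) (f := fun t => f t - f r) (f' := 0)
    (hc.sub continuousOn_const) (fun t ht => (hd t ht).sub_const _) (by simp) hr hs
  simpa [sub_eq_zero] using norm_le

lemma eq_of_hasDerivAt_zero_Iio {f : ℝ → ℝ} {a : ℝ} (hf : ∀ x < a, HasDerivAt f 0 x) {x y : ℝ}
    (hx : x < a) (hy : y < a) : f x = f y :=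
  isOpen_Iio.is_const_of_deriv_eq_zero isPreconnected_Iio
    (fun z hz => (hf z hz).differentiableAt.differentiableWithinAt)
    (fun z hz => (hf z hz).deriv) hx hy

lemma eq_zero_of_hasDerivAt_zero_Iio {f : ℝ → ℝ} {a : ℝ} (hf : ∀ x < a, HasDerivAt f 0 x)
    (hlim : Tendsto f atBot (𝓝 0)) {x : ℝ} (hx : x < a) : f x = 0 := by
  refine tendsto_nhds_unique (tendsto_const_nhds.congr' ?_) hlim
  filter_upwards [Iio_mem_atBot a] with y hy
  exact eq_of_hasDerivAt_zero_Iio hf hx hy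

lemma eq_zero_of_affine_of_tendsto_atBot {f f' : ℝ → ℝ} {a : ℝ}
    (hf : ∀ x < a, HasDerivAt f (f' x) x) (hf' : ∀ x < a, HasDerivAt f' 0 x)
    (hlim : Tendsto f atBot (𝓝 0)) {x : ℝ} (hx : x < a) : f x = 0 ∧ f' x = 0 := by
  have increment_eq (y : ℝ) (hy : y < a) : f y - f (y - 1) = f' x := by
    obtain ⟨z, hz, slope_eq⟩ := exists_hasDerivAt_eq_slope f f' (sub_one_lt y)
      (fun w hw => (hf w (hw.2.trans_lt hy)).continuousAt.continuousWithinAt)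
      (fun w hw => hf w (hw.2.trans hy))
    rw [eq_of_hasDerivAt_zero_Iio hf' hx (hz.2.trans hy), slope_eq]
    ring
  have tendsto_increment : Tendsto (fun y => f y - f (y - 1)) atBot (𝓝 0) := by
    simpa [sub_eq_add_neg] using
      hlim.sub (hlim.comp (tendsto_atBot_add_const_right _ (-1) tendsto_id))
  have deriv_zero : f' x = 0 := by
    refine tendsto_nhds_unique (tendsto_const_nhds.congr' ?_) tendsto_increment
    filter_upwards [Iio_mem_atBot a] with y hy
    exact (increment_eq y hy).symm
  refine ⟨eq_zero_of_hasDerivAt_zero_Iio (fun y hy => ?_) hlim hx, deriv_zero⟩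
  rw [← deriv_zero, eq_of_hasDerivAt_zero_Iio hf' hx hy]
  exact hf y hy

lemma mul_sub_le_log_sub_log {f : ℝ → ℝ} {a b l x y : ℝ} (hl : 0 < l)
    (hpos : ∀ z ∈ Ioo a b, 0 < f z) (hlog : ∀ z ∈ Ioo a b, l ≤ deriv f z / f z)
    (hx : x ∈ Ioo a b) (hy : y ∈ Ioo a b) (hxy : x < y) :
    l * (y - x) ≤ Real.log (f y) - Real.log (f x) := by
  have hasDerivAt_log {z : ℝ} (hz : z ∈ Ioo a b) :
      HasDerivAt (fun z => Real.log (f z)) (deriv f z / f z) z := by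
    refine (differentiableAt_of_deriv_ne_zero fun deriv_zero => ?_).hasDerivAt.log (hpos z hz).ne'
    have := hlog z hz
    rw [deriv_zero, zero_div] at this
    exact this.not_gt hl
  obtain ⟨c, hc, slope_eq⟩ := exists_hasDerivAt_eq_slope (fun z => Real.log (f z))
    (fun z => deriv f z / f z) hxy
    (fun z hz => (hasDerivAt_log
      ⟨hx.1.trans_le hz.1, hz.2.trans_lt hy.2⟩).continuousAt.continuousWithinAt)
    (fun z hz => hasDerivAt_log ⟨hx.1.trans hz.1, hz.2.trans hy.2⟩)
  rw [← le_div_iff₀ (sub_pos.2 hxy), ← slope_eq]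
  exact hlog c ⟨hx.1.trans hc.1, hc.2.trans hy.2⟩

lemma nonneg_of_hasDerivAt_of_monotoneOn {f : ℝ → ℝ} {f' x : ℝ} {s : Set ℝ} (hs : s ∈ 𝓝 x)
    (hf : HasDerivAt f f' x) (hmono : MonotoneOn f s) : 0 ≤ f' := by
  refine hf.hasDerivWithinAt.nonneg_of_monotoneOn (s := s) ?_ hmono
  exact (uniqueDiffWithinAt_iff_accPt (𝕜 := ℝ)).1 (uniqueDiffWithinAt_of_mem_nhds hs)

lemma nonpos_of_hasDerivAt_of_isMaxOn_right {f : ℝ → ℝ} {f' a b : ℝ} (hab : a < b)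
    (hf : HasDerivAt f f' a) (hmax : IsMaxOn f (Icc a b) a) : f' ≤ 0 := by
  have directional := hmax.localize.hasFDerivWithinAt_nonpos hf.hasFDerivAt.hasFDerivWithinAt
    (sub_mem_posTangentConeAt_of_segment_subset (segment_eq_Icc hab.le).subset)
  exact nonpos_of_mul_nonpos_right (by simpa using directional) (sub_pos.2 hab)

lemma nonneg_of_hasDerivAt_of_isMaxOn_left {f : ℝ → ℝ} {f' a b : ℝ} (hab : a < b)
    (hf : HasDerivAt f f' b) (hmax : IsMaxOn f (Icc a b) b) : 0 ≤ f' := by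
  have directional := hmax.localize.hasFDerivWithinAt_nonpos hf.hasFDerivAt.hasFDerivWithinAt
    (sub_mem_posTangentConeAt_of_segment_subset (y := a)
      ((segment_symm ℝ b a).trans (segment_eq_Icc hab.le)).subset)
  exact nonneg_of_mul_nonpos_right (by simpa using directional) (sub_neg.2 hab)

lemma deriv_deriv_nonpos_of_isLocalMax {f : ℝ → ℝ} {x : ℝ} (h : IsLocalMax f x)
    (hc : ContinuousAt f x) : deriv (deriv f) x ≤ 0 := by
  by_contra! second_pos
  have min := isLocalMin_of_deriv_deriv_pos second_pos h.deriv_eq_zero hc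
  have eventually_const : f =ᶠ[𝓝 x] fun _ => f x := by
    filter_upwards [h, min] with y hle hge
    exact le_antisymm hle hge
  rw [eventually_const.deriv.deriv_eq] at second_pos
  simp at second_pos

lemma nonpos_of_deriv_time_neg {τ a b : ℝ} {w : ℝ → ℝ → ℝ}
    (hc : ContinuousOn (Function.uncurry w) (Icc 0 τ ×ˢ Icc a b))
    (hinit : ∀ x ∈ Icc a b, w 0 x ≤ 0) (hleft : ∀ t ∈ Icc 0 τ, w t a ≤ 0)
    (hright : ∀ t ∈ Icc 0 τ, w t b ≤ 0)
    (hd : ∀ t ∈ Ioc 0 τ, ∀ x ∈ Ioo a b, DifferentiableAt ℝ (fun s => w s x) t)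
    (hw : ∀ t ∈ Ioc 0 τ, ∀ x ∈ Ioo a b, deriv (w t) x = 0 → deriv (deriv (w t)) x ≤ 0 →
      deriv (fun s => w s x) t < 0) {t x : ℝ} (ht : t ∈ Icc 0 τ) (hx : x ∈ Icc a b) :
    w t x ≤ 0 := by
  obtain ⟨⟨s, y⟩, ⟨hs, hy⟩, max⟩ :=
    (isCompact_Icc.prod isCompact_Icc).exists_isMaxOn ⟨(t, x), ht, hx⟩ hc
  refine (max (mk_mem_prod ht hx)).trans ?_
  change w s y ≤ 0
  rcases hs.1.eq_or_lt with rfl | s_pos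
  · exact hinit y hy
  rcases hy.1.eq_or_lt with rfl | a_lt
  · exact hleft s hs
  rcases hy.2.eq_or_lt with rfl | lt_b
  · exact hright s hs
  have space_max : IsLocalMax (w s) y := by
    filter_upwards [Icc_mem_nhds a_lt lt_b] with z hz
    exact max (mk_mem_prod hs hz)
  have space_continuous : ContinuousAt (w s) y :=
    (hc.comp (f := fun z => (s, z)) (by fun_prop) fun z hz => mk_mem_prod hs hz).continuousAt
      (Icc_mem_nhds a_lt lt_b)
  have time_nonneg : 0 ≤ deriv (fun r => w r y) s :=
    nonneg_of_hasDerivAt_of_isMaxOn_left s_pos (hd s ⟨s_pos, hs.2⟩ y ⟨a_lt, lt_b⟩).hasDerivAt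
      fun r hr => max (mk_mem_prod ⟨hr.1, hr.2.trans hs.2⟩ hy)
  exact absurd time_nonneg (hw s ⟨s_pos, hs.2⟩ y ⟨a_lt, lt_b⟩ space_max.deriv_eq_zero
    (deriv_deriv_nonpos_of_isLocalMax space_max space_continuous)).not_ge

theorem weak_maximum_principle {τ a b : ℝ} {w : ℝ → ℝ → ℝ}
    (hc : ContinuousOn (Function.uncurry w) (Icc 0 τ ×ˢ Icc a b))
    (hinit : ∀ x ∈ Icc a b, w 0 x ≤ 0) (hleft : ∀ t ∈ Icc 0 τ, w t a ≤ 0)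
    (hright : ∀ t ∈ Icc 0 τ, w t b ≤ 0)
    (hd : ∀ t ∈ Ioc 0 τ, ∀ x ∈ Ioo a b, DifferentiableAt ℝ (fun s => w s x) t)
    (hw : ∀ t ∈ Ioc 0 τ, ∀ x ∈ Ioo a b, deriv (w t) x = 0 → deriv (deriv (w t)) x ≤ 0 →
      deriv (fun s => w s x) t ≤ 0) {t x : ℝ} (ht : t ∈ Icc 0 τ) (hx : x ∈ Icc a b) :
    w t x ≤ 0 := by
  have perturbed (η : ℝ) (hη : 0 < η) : w t x - η * t ≤ 0 := by
    have boundary {s y : ℝ} (hs : s ∈ Icc 0 τ) (hle : w s y ≤ 0) : w s y - η * s ≤ 0 := by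
      linarith [mul_nonneg hη.le hs.1]
    refine nonpos_of_deriv_time_neg (w := fun s y => w s y - η * s)
      (hc.sub (by fun_prop)) (by simpa using hinit) (fun s hs => boundary hs (hleft s hs))
      (fun s hs => boundary hs (hright s hs)) (fun s hs y hy => (hd s hs y hy).sub (by fun_prop))
      (fun s hs y hy => ?_) ht hx
    have time_deriv : deriv (fun r => w r y - η * r) s = deriv (fun r => w r y) s - η := by
      rw [deriv_fun_sub (hd s hs y hy) (by fun_prop), deriv_const_mul_id]
    simp only [deriv_sub_const_fun, time_deriv]
    exact fun first second => by linarith [hw s hs y hy first second]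
  have tendsto_perturbed : Tendsto (fun η => w t x - η * t) (𝓝[>] 0) (𝓝 (w t x)) :=
    (Continuous.tendsto' (by fun_prop) 0 _ (by simp)).mono_left nhdsWithin_le_nhds
  exact le_of_tendsto tendsto_perturbed (eventually_mem_nhdsWithin.mono perturbed)

end Calculus

section Trajectories

/-- A velocity field on `[0,T]` that is bounded by `M` and spatially `M`-Lipschitz. -/
structure IsLipschitzVelocity {E : Type*} [NormedAddCommGroup E] (T : ℝ) (M : ℝ≥0)
    (u : ℝ → E → E) : Prop where
  continuousOn_velocity : ContinuousOn (Function.uncurry u) (Icc 0 T ×ˢ univ)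
  norm_velocity_le : ∀ t ∈ Icc 0 T, ∀ x, ‖u t x‖ ≤ M
  lipschitzWith : ∀ t ∈ Icc 0 T, LipschitzWith M (u t)

/-- `Z` is a trajectory of the velocity field `u` on `[0,T]`. -/
structure IsTrajectory {E : Type*} [NormedAddCommGroup E] [NormedSpace ℝ E] (T : ℝ)
    (u : ℝ → E → E) (Z : ℝ → E) : Prop where
  continuousOn : ContinuousOn Z (Icc 0 T)
  hasDerivAt : ∀ t ∈ Ioo 0 T, HasDerivAt Z (u t (Z t)) t

namespace IsLipschitzVelocity

variable {E : Type*} [NormedAddCommGroup E] {T : ℝ} {M : ℝ≥0} {u : ℝ → E → E}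

lemma continuousOn_time (h : IsLipschitzVelocity T M u) (x : E) :
    ContinuousOn (fun t => u t x) (Icc 0 T) :=
  h.continuousOn_velocity.comp (f := fun t => (t, x)) (by fun_prop) fun _ ht => ⟨ht, mem_univ _⟩

lemma norm_velocity_sub_le (h : IsLipschitzVelocity T M u) {t : ℝ} (ht : t ∈ Ioo 0 T) (x y : E) :
    ‖u t x - u t y‖ ≤ M * ‖x - y‖ :=
  (h.lipschitzWith t (Ioo_subset_Icc_self ht)).norm_sub_le x y

variable [NormedSpace ℝ E] {Z W : ℝ → E}

lemma exists_trajectory [CompleteSpace E] (h : IsLipschitzVelocity T M u) {t : ℝ}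
    (ht : t ∈ Icc 0 T) (x : E) : ∃ Z, IsTrajectory T u Z ∧ Z t = x := by
  have picard : IsPicardLindelof u (tmin := 0) (tmax := T) ⟨t, ht⟩ x
      (M * ⟨T, ht.1.trans ht.2⟩) 0 M M := by
    refine ⟨fun s hs => (h.lipschitzWith s hs).lipschitzOnWith, fun y _ => h.continuousOn_time y,
      fun s hs y _ => h.norm_velocity_le s hs y, ?_⟩
    simp only [NNReal.coe_zero, sub_zero]
    exact mul_le_mul_of_nonneg_left (max_le (by linarith [ht.1]) ht.2) M.coe_nonneg
  obtain ⟨Z, Z_t, Z_deriv⟩ := picard.exists_eq_forall_mem_Icc_hasDerivWithinAt₀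
  exact ⟨Z, ⟨fun s hs => (Z_deriv s hs).continuousWithinAt,
    fun s hs => (Z_deriv s ⟨hs.1.le, hs.2.le⟩).hasDerivAt (Icc_mem_nhds hs.1 hs.2)⟩, Z_t⟩

lemma norm_trajectory_sub_le (h : IsLipschitzVelocity T M u) (hZ : IsTrajectory T u Z)
    (hW : IsTrajectory T u W) {r s : ℝ} (hr : r ∈ Icc 0 T) (hs : s ∈ Icc 0 T) :
    ‖W s - Z s‖ ≤ Real.exp (M * T) * ‖W r - Z r‖ := by
  refine (norm_le_exp_mul_norm (f := fun t => W t - Z t) (hW.continuousOn.sub hZ.continuousOn)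
    (fun t ht => (hW.hasDerivAt t ht).sub (hZ.hasDerivAt t ht))
    (fun t ht => h.norm_velocity_sub_le ht _ _) hr hs).trans ?_
  gcongr
  exact abs_sub_le_iff.2 ⟨by linarith [hr.1, hs.2], by linarith [hs.1, hr.2]⟩

lemma lipschitzOnWith_trajectory (h : IsLipschitzVelocity T M u) (hT : T ≠ 0)
    (hZ : IsTrajectory T u Z) : LipschitzOnWith M Z (Icc 0 T) := by
  rw [← closure_Ioo hT.symm]
  refine LipschitzOnWith.closure ?_ ?_
  · rw [closure_Ioo hT.symm]
    exact hZ.continuousOn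
  · exact (convex_Ioo 0 T).lipschitzOnWith_of_nnnorm_hasDerivWithin_le
      (fun t ht => (hZ.hasDerivAt t ht).hasDerivWithinAt)
      fun t ht => h.norm_velocity_le t (Ioo_subset_Icc_self ht) _

end IsLipschitzVelocity

lemma IsLipschitzVelocity.trajectory_lt {T : ℝ} {M : ℝ≥0} {u : ℝ → ℝ → ℝ}
    (h : IsLipschitzVelocity T M u) {Z W : ℝ → ℝ} (hZ : IsTrajectory T u Z)
    (hW : IsTrajectory T u W) {r s : ℝ} (hr : r ∈ Icc 0 T) (hs : s ∈ Icc 0 T)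
    (hlt : Z r < W r) : Z s < W s :=
  sub_pos.1 (pos_of_abs_deriv_le (f := fun t => W t - Z t)
    (hW.continuousOn.sub hZ.continuousOn)
    (fun t ht => (hW.hasDerivAt t ht).sub (hZ.hasDerivAt t ht))
    (fun _ ht => h.norm_velocity_sub_le ht _ _) hr hs (sub_pos.2 hlt))

lemma IsLipschitzVelocity.initial_mem_Ioo {T : ℝ} {M : ℝ≥0} {u : ℝ → ℝ → ℝ}
    (h : IsLipschitzVelocity T M u) {a b c t : ℝ} {W : ℝ → ℝ}
    (ha : IsTrajectory T u fun _ => a) (hW : IsTrajectory T u W) (ht : t ∈ Ioo 0 T)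
    (hcb : c + M * t ≤ b) (hWt : W t ∈ Ioo a c) : W 0 ∈ Ioo a b := by
  have zero_mem : (0 : ℝ) ∈ Icc 0 T := ⟨le_rfl, (ht.1.trans ht.2).le⟩
  have htI := Ioo_subset_Icc_self ht
  refine ⟨h.trajectory_lt ha hW htI zero_mem hWt.1, ?_⟩
  have displacement := (h.lipschitzOnWith_trajectory (ht.1.trans ht.2).ne' hW).norm_sub_le
    zero_mem htI
  rw [zero_sub, norm_neg, Real.norm_of_nonneg ht.1.le] at displacement
  linarith [Real.le_norm_self (W 0 - W t), hWt.2]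

end Trajectories

section Transport

/-- `ρ` is continuous and solves the continuity equation `ρ_t + (ρ u)_x = 0`, written along the
trajectories of the velocity field `u` with spatial derivative `ux`. -/
structure IsTransported (T : ℝ) (M : ℝ≥0) (ρ u ux : ℝ → ℝ → ℝ) : Prop
    extends IsLipschitzVelocity T M u where
  continuousOn_density : ContinuousOn (Function.uncurry ρ) (Icc 0 T ×ˢ univ)
  hasDerivAt_velocity : ∀ t ∈ Icc 0 T, ∀ x, HasDerivAt (u t) (ux t x) x
  transport : ∀ Z : ℝ → ℝ, ∀ t ∈ Ioo 0 T, HasDerivAt Z (u t (Z t)) t →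
    HasDerivAt (fun s => ρ s (Z s)) (-(ux t (Z t) * ρ t (Z t))) t

namespace IsTransported

variable {T : ℝ} {M : ℝ≥0} {ρ u ux : ℝ → ℝ → ℝ} {Z : ℝ → ℝ}

lemma continuousOn_comp_trajectory (h : IsTransported T M ρ u ux) (hZ : IsTrajectory T u Z) :
    ContinuousOn (fun t => ρ t (Z t)) (Icc 0 T) :=
  h.continuousOn_density.comp (f := fun t => (t, Z t)) (continuousOn_id.prodMk hZ.continuousOn)
    fun _ ht => ⟨ht, mem_univ _⟩

lemma abs_gradient_mul_density_le (h : IsTransported T M ρ u ux) {t : ℝ} (ht : t ∈ Ioo 0 T)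
    (x : ℝ) : |-(ux t x * ρ t x)| ≤ M * |ρ t x| := by
  rw [abs_neg, abs_mul]
  gcongr
  have htI := Ioo_subset_Icc_self ht
  exact (h.hasDerivAt_velocity t htI x).le_of_lipschitz (h.lipschitzWith t htI)

lemma density_pos (h : IsTransported T M ρ u ux) (hZ : IsTrajectory T u Z) {r s : ℝ}
    (hr : r ∈ Icc 0 T) (hs : s ∈ Icc 0 T) (hpos : 0 < ρ r (Z r)) : 0 < ρ s (Z s) :=
  pos_of_abs_deriv_le (f := fun t => ρ t (Z t)) (h.continuousOn_comp_trajectory hZ)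
    (fun t ht => h.transport Z t ht (hZ.hasDerivAt t ht))
    (fun _ ht => h.abs_gradient_mul_density_le ht _) hr hs hpos

lemma density_eq_zero (h : IsTransported T M ρ u ux) (hZ : IsTrajectory T u Z) {r s : ℝ}
    (hr : r ∈ Icc 0 T) (hs : s ∈ Icc 0 T) (h0 : ρ r (Z r) = 0) : ρ s (Z s) = 0 := by
  have norm_le := norm_le_exp_mul_norm (f := fun t => ρ t (Z t)) (h.continuousOn_comp_trajectory hZ)
    (fun t ht => h.transport Z t ht (hZ.hasDerivAt t ht))
    (fun _ ht => h.abs_gradient_mul_density_le ht _) hr hs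
  rwa [h0, norm_zero, mul_zero, norm_le_zero_iff] at norm_le

lemma density_nonneg (h : IsTransported T M ρ u ux) (h0 : ∀ x, 0 ≤ ρ 0 x) {t : ℝ}
    (ht : t ∈ Icc 0 T) (x : ℝ) : 0 ≤ ρ t x := by
  obtain ⟨Z, hZ, rfl⟩ := h.exists_trajectory ht x
  have zero_mem : (0 : ℝ) ∈ Icc 0 T := ⟨le_rfl, ht.1.trans ht.2⟩
  rcases (h0 (Z 0)).eq_or_lt with vacuum | pos
  · exact (h.density_eq_zero hZ zero_mem ht vacuum.symm).ge
  · exact (h.density_pos hZ zero_mem ht pos).le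

lemma density_eq_zero_of_lt_trajectory (h : IsTransported T M ρ u ux) (hZ : IsTrajectory T u Z)
    (hvac : ∀ x < Z 0, ρ 0 x = 0) {t x : ℝ} (ht : t ∈ Icc 0 T) (hx : x < Z t) : ρ t x = 0 := by
  obtain ⟨W, hW, rfl⟩ := h.exists_trajectory ht x
  have zero_mem : (0 : ℝ) ∈ Icc 0 T := ⟨le_rfl, ht.1.trans ht.2⟩
  exact h.density_eq_zero hW zero_mem ht (hvac _ (h.trajectory_lt hW hZ ht zero_mem hx))

lemma density_pos_of_mem_Ioo (h : IsTransported T M ρ u ux) {a b c t x : ℝ}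
    (ha : IsTrajectory T u fun _ => a) (hpos : ∀ y ∈ Ioo a b, 0 < ρ 0 y) (ht : t ∈ Ioo 0 T)
    (hcb : c + M * t ≤ b) (hx : x ∈ Ioo a c) : 0 < ρ t x := by
  have htI := Ioo_subset_Icc_self ht
  obtain ⟨W, hW, rfl⟩ := h.exists_trajectory htI x
  exact h.density_pos hW ⟨le_rfl, (ht.1.trans ht.2).le⟩ htI
    (hpos _ (h.initial_mem_Ioo ha hW ht hcb hx))

lemma hasDerivAt_log_density (h : IsTransported T M ρ u ux) (hZ : IsTrajectory T u Z) {t : ℝ}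
    (ht : t ∈ Ioo 0 T) (hpos : 0 < ρ t (Z t)) :
    HasDerivAt (fun s => Real.log (ρ s (Z s))) (-ux t (Z t)) t := by
  convert! (h.transport Z t ht (hZ.hasDerivAt t ht)).log hpos.ne' using 1
  field_simp

end IsTransported

end Transport

section StrongSolution

/-- The expression `ρ (u_t + u u_x) + p(ρ)_x`, i.e. the left-hand side of the momentum equation
reduced by the continuity equation, in terms of the values `r = ρ`, `v = u` and their
derivatives. -/
def momentumBalance (A γ r rx v vx vt : ℝ) : ℝ :=
  r * (vt + v * vx) + A * γ * r ^ (γ - 1) * rx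

/-- A pointwise solution of the equations with viscosity `ν` on `[0,T]`, whose velocity vanishes at
infinity and has an `L`-Lipschitz spatial derivative `ux`. -/
structure IsStrongSolution (ν A γ T : ℝ) (M L : ℝ≥0) (ρ u ux : ℝ → ℝ → ℝ) : Prop
    extends IsTransported T M ρ u ux where
  tendsto_velocity : ∀ t ∈ Icc 0 T, Tendsto (u t) (cocompact ℝ) (𝓝 0)
  lipschitzWith_gradient : ∀ t ∈ Ioo 0 T, LipschitzWith L (ux t)
  momentum : ∀ t ∈ Ioo 0 T, ∀ x, ∃ ρx ut uxx : ℝ, HasDerivAt (ρ t) ρx x ∧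
    HasDerivAt (fun s => u s x) ut t ∧ HasDerivAt (ux t) uxx x ∧
    momentumBalance A γ (ρ t x) ρx (u t x) (ux t x) ut = ν * uxx

/-- The initial data `(ρ₀, u₀)` have a vacuum on the left of `a`, a density that grows at least
like `exp (l x)` on `(a,b)`, and a velocity on `(a,b)` that points towards the vacuum. A right
interface is a left interface of the reflected data `(ρ₀ (-x), -u₀ (-x))`. -/
structure IsLeftInterface (ρ₀ u₀ : ℝ → ℝ) (a b l : ℝ) : Prop where
  lt : a < b
  rate_pos : 0 < l
  vacuum : ∀ x < a, ρ₀ x = 0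
  density_pos : ∀ x ∈ Ioo a b, 0 < ρ₀ x
  le_logDeriv : ∀ x ∈ Ioo a b, l ≤ deriv ρ₀ x / ρ₀ x
  velocity_nonpos : ∀ x ∈ Ioo a b, u₀ x ≤ 0
  velocity_neg : u₀ b < 0

/-- The barrier `ε (exp (k (x - s(t))) - 1)`, which vanishes on the line `s(t) = b - σ t`. -/
def barrier (ε k σ b t x : ℝ) : ℝ := ε * (Real.exp (k * (x - b + σ * t)) - 1)

section Barrier

variable {ε k σ b : ℝ}

lemma hasDerivAt_barrier_time (t x : ℝ) : HasDerivAt (fun s => barrier ε k σ b s x)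
    (σ * (ε * k * Real.exp (k * (x - b + σ * t)))) t := by
  have linear : HasDerivAt (fun s => k * (x - b + σ * s)) (k * (σ * 1)) t :=
    (((hasDerivAt_id t).const_mul σ).const_add (x - b)).const_mul k
  refine ((linear.exp.sub_const 1).const_mul ε).congr_deriv ?_
  ring

lemma hasDerivAt_exp_barrier (t x : ℝ) : HasDerivAt (fun y => Real.exp (k * (y - b + σ * t)))
    (k * Real.exp (k * (x - b + σ * t))) x := by
  have linear : HasDerivAt (fun y => k * (y - b + σ * t)) (k * 1) x :=
    (((hasDerivAt_id x).sub_const b).add_const (σ * t)).const_mul k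
  refine linear.exp.congr_deriv ?_
  ring

lemma hasDerivAt_barrier (t x : ℝ) : HasDerivAt (barrier ε k σ b t)
    (ε * k * Real.exp (k * (x - b + σ * t))) x :=
  (((hasDerivAt_exp_barrier t x).sub_const 1).const_mul ε).congr_deriv (mul_assoc ..).symm

lemma continuous_barrier : Continuous (Function.uncurry (barrier ε k σ b)) := by
  unfold barrier Function.uncurry
  fun_prop

lemma barrier_nonpos {t x : ℝ} (hε : 0 ≤ ε) (hk : 0 ≤ k) (hx : x + σ * t ≤ b) :
    barrier ε k σ b t x ≤ 0 := by
  refine mul_nonpos_of_nonneg_of_nonpos hε (sub_nonpos.2 (Real.exp_le_one_iff.2 ?_))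
  exact mul_nonpos_of_nonneg_of_nonpos hk (by linarith)

/- At a critical point of `u + barrier` with `q = barrier_x`, the pressure gradient and the
viscosity both push `(u + barrier)_t` down, and `ν k` dominates the drift. -/
lemma time_deriv_nonpos_of_momentumBalance {A γ ν r rx v vx vt vxx q : ℝ}
    (heq : momentumBalance A γ r rx v vx vt = ν * vxx) (hr : 0 < r) (hA : 0 ≤ A * γ)
    (hrx : 0 ≤ rx) (hν : 0 ≤ ν) (hq : 0 ≤ q) (hdrift : r * (σ + v) ≤ ν * k)
    (first : vx + q = 0) (second : vxx + k * q ≤ 0) : vt + σ * q ≤ 0 := by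
  have pressure_nonneg : 0 ≤ A * γ * r ^ (γ - 1) * rx := by positivity
  refine nonpos_of_mul_nonpos_right ?_ hr
  calc r * (vt + σ * q)
      = ν * vxx - A * γ * r ^ (γ - 1) * rx + r * (σ + v) * q := by
        rw [← heq, momentumBalance, eq_neg_of_add_eq_zero_left first]
        ring
    _ ≤ ν * (-(k * q)) - 0 + ν * k * q := by
        gcongr
        linarith
    _ = 0 := by ring

end Barrier

namespace IsStrongSolution

variable {ν A γ T : ℝ} {M L : ℝ≥0} {ρ u ux : ℝ → ℝ → ℝ} {a b t : ℝ}

lemma hasDerivAt_gradient_of_vacuum (h : IsStrongSolution ν A γ T M L ρ u ux) (hν : ν ≠ 0)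
    (ht : t ∈ Ioo 0 T) (hvac : ∀ x < a, ρ t x = 0) {x : ℝ} (hx : x < a) :
    HasDerivAt (ux t) 0 x := by
  obtain ⟨ρx, ut, uxx, hρx, -, huxx, momentum⟩ := h.momentum t ht x
  have ρx_zero : ρx = 0 := hρx.unique ((hasDerivAt_const x (0 : ℝ)).congr_of_eventuallyEq
    (by filter_upwards [Iio_mem_nhds hx] using hvac))
  rw [momentumBalance, ρx_zero, hvac x hx, zero_mul, mul_zero, add_zero] at momentum
  rwa [(mul_eq_zero.1 momentum.symm).resolve_left hν] at huxx

lemma velocity_eq_zero_of_vacuum (h : IsStrongSolution ν A γ T M L ρ u ux) (hν : ν ≠ 0)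
    (ht : t ∈ Ioo 0 T) (hvac : ∀ x < a, ρ t x = 0) : u t a = 0 ∧ ux t a = 0 := by
  have htI := Ioo_subset_Icc_self ht
  have interior (x : ℝ) (hx : x < a) : u t x = 0 ∧ ux t x = 0 :=
    eq_zero_of_affine_of_tendsto_atBot (fun y _ => h.hasDerivAt_velocity t htI y)
      (fun y hy => h.hasDerivAt_gradient_of_vacuum hν ht hvac hy)
      ((h.tendsto_velocity t htI).mono_left atBot_le_cocompact) hx
  have a_mem : a ∈ closure (Iio a) := by simp
  exact ⟨EqOn.closure (fun x hx => (interior x hx).1) (h.lipschitzWith t htI).continuous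
      continuous_const a_mem,
    EqOn.closure (fun x hx => (interior x hx).2) (h.lipschitzWith_gradient t ht).continuous
      continuous_const a_mem⟩

lemma isTrajectory_interface (h : IsStrongSolution ν A γ T M L ρ u ux) (hν : ν ≠ 0) (hT : 0 ≤ T)
    (hvac : ∀ x < a, ρ 0 x = 0) : IsTrajectory T u fun _ => a := by
  have zero_mem : (0 : ℝ) ∈ Icc 0 T := ⟨le_rfl, hT⟩
  obtain ⟨Z, hZ, rfl⟩ := h.exists_trajectory zero_mem a
  have velocity_zero (s : ℝ) (hs : s ∈ Ioo 0 T) : u s (Z s) = 0 :=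
    (h.velocity_eq_zero_of_vacuum hν hs fun _ hx =>
      h.density_eq_zero_of_lt_trajectory hZ hvac (Ioo_subset_Icc_self hs) hx).1
  have hasDerivAt_zero (s : ℝ) (hs : s ∈ Ioo 0 T) : HasDerivAt Z 0 s := by
    simpa only [velocity_zero s hs] using hZ.hasDerivAt s hs
  refine ⟨continuousOn_const, fun s hs => ?_⟩
  rw [← eq_of_hasDerivAt_zero_Ioo hZ.continuousOn hasDerivAt_zero zero_mem
    (Ioo_subset_Icc_self hs), velocity_zero s hs]
  exact hasDerivAt_const s _

lemma velocity_interface (h : IsStrongSolution ν A γ T M L ρ u ux) (hν : ν ≠ 0)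
    (hvac : ∀ x < a, ρ 0 x = 0) (ht : t ∈ Ioo 0 T) : u t a = 0 ∧ ux t a = 0 :=
  h.velocity_eq_zero_of_vacuum hν ht fun _ hx => h.density_eq_zero_of_lt_trajectory
    (h.isTrajectory_interface hν (ht.1.trans ht.2).le hvac) hvac (Ioo_subset_Icc_self ht) hx

lemma gradient_sub_ge (h : IsStrongSolution ν A γ T M L ρ u ux) {X Y : ℝ → ℝ}
    (hX : IsTrajectory T u X) (hY : IsTrajectory T u Y) (ht : t ∈ Ioo 0 T) :
    -(L * Real.exp (M * T) * |Y 0 - X 0|) ≤ -ux t (Y t) - -ux t (X t) := by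
  have gradient_le := (h.lipschitzWith_gradient t ht).norm_sub_le (Y t) (X t)
  have spread_le := h.norm_trajectory_sub_le hX hY (r := 0) ⟨le_rfl, (ht.1.trans ht.2).le⟩
    (Ioo_subset_Icc_self ht)
  calc -(L * Real.exp (M * T) * |Y 0 - X 0|)
      ≤ -‖ux t (Y t) - ux t (X t)‖ := by
        rw [mul_assoc]
        exact neg_le_neg (gradient_le.trans (mul_le_mul_of_nonneg_left spread_le L.coe_nonneg))
    _ ≤ -ux t (Y t) - -ux t (X t) := by
        linarith [Real.le_norm_self (ux t (Y t) - ux t (X t))]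

lemma log_density_sub_ge (h : IsStrongSolution ν A γ T M L ρ u ux) {X Y : ℝ → ℝ}
    (hX : IsTrajectory T u X) (hY : IsTrajectory T u Y) (hX0 : 0 < ρ 0 (X 0))
    (hY0 : 0 < ρ 0 (Y 0)) (ht : t ∈ Ioo 0 T) :
    Real.log (ρ 0 (Y 0)) - Real.log (ρ 0 (X 0)) - L * Real.exp (M * T) * |Y 0 - X 0| * t ≤
      Real.log (ρ t (Y t)) - Real.log (ρ t (X t)) := by
  have zero_mem : (0 : ℝ) ∈ Icc 0 T := ⟨le_rfl, (ht.1.trans ht.2).le⟩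
  have X_pos (s : ℝ) (hs : s ∈ Icc 0 T) := h.density_pos hX zero_mem hs hX0
  have Y_pos (s : ℝ) (hs : s ∈ Icc 0 T) := h.density_pos hY zero_mem hs hY0
  have continuousOn_ratio :
      ContinuousOn (fun s => Real.log (ρ s (Y s)) - Real.log (ρ s (X s))) (Icc 0 T) :=
    ((h.continuousOn_comp_trajectory hY).log fun s hs => (Y_pos s hs).ne').sub
      ((h.continuousOn_comp_trajectory hX).log fun s hs => (X_pos s hs).ne')
  obtain ⟨s, hs, slope_eq⟩ := exists_hasDerivAt_eq_slope _
    (fun s => -ux s (Y s) - -ux s (X s)) ht.1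
    (continuousOn_ratio.mono (Icc_subset_Icc_right ht.2.le)) fun s hs => by
      have hsT : s ∈ Ioo 0 T := ⟨hs.1, hs.2.trans ht.2⟩
      have hsI := Ioo_subset_Icc_self hsT
      exact (h.hasDerivAt_log_density hY hsT (Y_pos s hsI)).sub
        (h.hasDerivAt_log_density hX hsT (X_pos s hsI))
  have slope_ge := h.gradient_sub_ge hX hY ⟨hs.1, hs.2.trans ht.2⟩
  rw [slope_eq, sub_zero, le_div_iff₀ ht.1] at slope_ge
  linarith

lemma density_monotoneOn (h : IsStrongSolution ν A γ T M L ρ u ux) {c l : ℝ} (hl : 0 < l)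
    (ha : IsTrajectory T u fun _ => a) (hpos : ∀ x ∈ Ioo a b, 0 < ρ 0 x)
    (hlog : ∀ x ∈ Ioo a b, l ≤ deriv (ρ 0) x / ρ 0 x) (ht : t ∈ Ioo 0 T) (hcb : c + M * t ≤ b)
    (hlt : L * Real.exp (M * T) * t ≤ l) : MonotoneOn (ρ t) (Ioo a c) := by
  have zero_mem : (0 : ℝ) ∈ Icc 0 T := ⟨le_rfl, (ht.1.trans ht.2).le⟩
  have htI := Ioo_subset_Icc_self ht
  rw [monotoneOn_iff_forall_lt]
  intro x hx y hy hxy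
  refine (Real.log_le_log_iff (h.density_pos_of_mem_Ioo ha hpos ht hcb hx)
    (h.density_pos_of_mem_Ioo ha hpos ht hcb hy)).1 ?_
  obtain ⟨X, hX, rfl⟩ := h.exists_trajectory htI x
  obtain ⟨Y, hY, rfl⟩ := h.exists_trajectory htI y
  have X_mem := h.initial_mem_Ioo ha hX ht hcb hx
  have Y_mem := h.initial_mem_Ioo ha hY ht hcb hy
  have X_lt_Y : X 0 < Y 0 := h.trajectory_lt hX hY htI zero_mem hxy
  have initial := mul_sub_le_log_sub_log hl hpos hlog X_mem Y_mem X_lt_Y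
  have later := h.log_density_sub_ge hX hY (hpos _ X_mem) (hpos _ Y_mem) ht
  rw [abs_of_pos (sub_pos.2 X_lt_Y)] at later
  linarith [mul_le_mul_of_nonneg_right hlt (sub_pos.2 X_lt_Y).le]

lemma add_barrier_nonpos (h : IsStrongSolution ν A γ T M L ρ u ux) {τ ε k σ : ℝ} (hτ : τ < T)
    (hν : 0 ≤ ν) (hA : 0 ≤ A * γ) (hε : 0 ≤ ε) (hk : 0 ≤ k)
    (hρ : ∀ t ∈ Ioc 0 τ, ∀ x ∈ Ioo a b, 0 < ρ t x)
    (hmono : ∀ t ∈ Ioc 0 τ, MonotoneOn (ρ t) (Ioo a b))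
    (hdrift : ∀ t ∈ Ioc 0 τ, ∀ x ∈ Ioo a b, ρ t x * (σ + u t x) ≤ ν * k)
    (hinit : ∀ x ∈ Icc a b, u 0 x + barrier ε k σ b 0 x ≤ 0)
    (hleft : ∀ t ∈ Icc 0 τ, u t a + barrier ε k σ b t a ≤ 0)
    (hright : ∀ t ∈ Icc 0 τ, u t b + barrier ε k σ b t b ≤ 0) {x : ℝ} (ht : t ∈ Icc 0 τ)
    (hx : x ∈ Icc a b) : u t x + barrier ε k σ b t x ≤ 0 := by
  have mem_Ioo {t : ℝ} (ht : t ∈ Ioc 0 τ) : t ∈ Ioo 0 T := ⟨ht.1, ht.2.trans_lt hτ⟩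
  refine weak_maximum_principle (w := fun t x => u t x + barrier ε k σ b t x)
    ((h.continuousOn_velocity.mono (prod_mono (Icc_subset_Icc_right hτ.le) (subset_univ _))).add
      continuous_barrier.continuousOn) hinit hleft hright (fun t ht x _ => ?_)
    (fun t ht x hx first second => ?_) ht hx
  · obtain ⟨-, ut, -, -, hut, -⟩ := h.momentum t (mem_Ioo ht) x
    exact (hut.add (hasDerivAt_barrier_time t x)).differentiableAt
  obtain ⟨ρx, ut, uxx, hρx, hut, huxx, momentum⟩ := h.momentum t (mem_Ioo ht) x
  have space_deriv : deriv (fun x => u t x + barrier ε k σ b t x) =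
      fun y => ux t y + ε * k * Real.exp (k * (y - b + σ * t)) := funext fun y =>
    ((h.hasDerivAt_velocity t (Ioo_subset_Icc_self (mem_Ioo ht)) y).add
      (hasDerivAt_barrier t y)).deriv
  rw [space_deriv] at first second
  rw [(huxx.fun_add ((hasDerivAt_exp_barrier t x).const_mul (ε * k))).deriv, mul_left_comm]
    at second
  rw [(hut.fun_add (hasDerivAt_barrier_time t x)).deriv]
  exact time_deriv_nonpos_of_momentumBalance momentum (hρ t ht x hx) hA
    (nonneg_of_hasDerivAt_of_monotoneOn (Ioo_mem_nhds hx.1 hx.2) hρx (hmono t ht)) hν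
    (by positivity) (hdrift t ht x hx) first second

lemma exists_drift_le (h : IsStrongSolution ν A γ T M L ρ u ux) (hν : 0 < ν) (a b σ : ℝ) :
    ∃ k > 0, ∀ t ∈ Icc 0 T, ∀ x ∈ Icc a b, ρ t x * (σ + u t x) ≤ ν * k := by
  have continuousOn_drift :
      ContinuousOn (fun q : ℝ × ℝ => ρ q.1 q.2 * (σ + u q.1 q.2)) (Icc 0 T ×ˢ Icc a b) :=
    (h.continuousOn_density.mul (continuousOn_const.add h.continuousOn_velocity)).mono
      (prod_mono_right (subset_univ _))
  obtain ⟨C, hC⟩ :=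
    (isCompact_Icc.prod isCompact_Icc).exists_bound_of_continuousOn continuousOn_drift
  refine ⟨max C 1 / ν, by positivity, fun t ht x hx => ?_⟩
  rw [mul_div_cancel₀ _ hν.ne']
  exact ((Real.le_norm_self _).trans (hC (t, x) ⟨ht, hx⟩)).trans (le_max_left ..)

/- The Hopf boundary point lemma. The barrier is nonpositive at `t = 0` and on `x = a` because its
zero line sweeps from `b` to `a` during `[0,τ]`; at time `τ` it is `ε (exp (k (x - a)) - 1)`. -/
lemma gradient_neg_of_velocity_nonpos (h : IsStrongSolution ν A γ T M L ρ u ux) {τ δ : ℝ}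
    (hν : 0 < ν) (hA : 0 ≤ A * γ) (hab : a < b) (hτ : τ ∈ Ioo 0 T) (hδ : 0 < δ)
    (hρ : ∀ t ∈ Ioc 0 τ, ∀ x ∈ Ioo a b, 0 < ρ t x)
    (hmono : ∀ t ∈ Ioc 0 τ, MonotoneOn (ρ t) (Ioo a b))
    (hinit : ∀ x ∈ Icc a b, u 0 x ≤ 0) (hleft : ∀ t ∈ Icc 0 τ, u t a ≤ 0)
    (hright : ∀ t ∈ Icc 0 τ, u t b ≤ -δ) (hzero : u τ a = 0) : ux τ a < 0 := by
  set σ := (b - a) / τ with hσ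
  obtain ⟨k, hk, hdrift⟩ := h.exists_drift_le hν a b σ
  have σ_mul_le (t : ℝ) (ht : t ∈ Icc 0 τ) : σ * t ≤ b - a := by
    rw [hσ, div_mul_eq_mul_div, div_le_iff₀ hτ.1]
    exact mul_le_mul_of_nonneg_left ht.2 (sub_pos.2 hab).le
  set ε := δ / Real.exp (k * (b - a)) with hε
  have ε_pos : 0 < ε := by positivity
  have right_barrier (t : ℝ) (ht : t ∈ Icc 0 τ) : barrier ε k σ b t b ≤ δ := by
    rw [barrier, hε, div_mul_eq_mul_div, div_le_iff₀ (Real.exp_pos _), sub_self, zero_add]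
    gcongr
    linarith [Real.exp_le_exp.2 (mul_le_mul_of_nonneg_left (σ_mul_le t ht) hk.le)]
  have comparison {x : ℝ} (hx : x ∈ Icc a b) : u τ x + barrier ε k σ b τ x ≤ 0 :=
    h.add_barrier_nonpos hτ.2 hν.le hA ε_pos.le hk.le hρ hmono
      (fun t ht x hx => hdrift t ⟨ht.1.le, ht.2.trans hτ.2.le⟩ x (Ioo_subset_Icc_self hx))
      (fun x hx => add_nonpos (hinit x hx)
        (barrier_nonpos ε_pos.le hk.le (by simpa using hx.2)))
      (fun t ht => add_nonpos (hleft t ht)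
        (barrier_nonpos ε_pos.le hk.le (by linarith [σ_mul_le t ht])))
      (fun t ht => by linarith [hright t ht, right_barrier t ht]) ⟨hτ.1.le, le_rfl⟩ hx
  have exponent_zero : a - b + σ * τ = 0 := by
    rw [hσ, div_mul_cancel₀ _ hτ.1.ne']
    ring
  have barrier_zero : barrier ε k σ b τ a = 0 := by simp [barrier, exponent_zero]
  have slope_nonpos := nonpos_of_hasDerivAt_of_isMaxOn_right hab
    ((h.hasDerivAt_velocity τ (Ioo_subset_Icc_self hτ) a).add
      (hasDerivAt_barrier (ε := ε) (k := k) (σ := σ) (b := b) τ a))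
    (fun x hx => by simpa [hzero, barrier_zero] using comparison hx)
  rw [exponent_zero, mul_zero, Real.exp_zero, mul_one] at slope_nonpos
  linarith [mul_pos ε_pos hk]

lemma exists_short_time_bounds (h : IsStrongSolution ν A γ T M L ρ u ux) (hT : 0 < T)
    {c l δ : ℝ} (hl : 0 < l) (hcb : c < b) (hδ : u 0 c < -δ) :
    ∃ τ > 0, ∀ t ∈ Icc 0 τ, t < T ∧ c + M * t ≤ b ∧ L * Real.exp (M * T) * t ≤ l ∧ u t c ≤ -δ := by
  have eventually_velocity_le : ∀ᶠ t in 𝓝[≥] (0 : ℝ), u t c ≤ -δ := by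
    rw [← nhdsWithin_Icc_eq_nhdsGE hT]
    exact ((h.continuousOn_time c 0 ⟨le_rfl, hT.le⟩).eventually_lt continuousWithinAt_const
      hδ).mono fun _ => le_of_lt
  have eventually_le {f : ℝ → ℝ} (hf : Continuous f) {C : ℝ} (hC : f 0 < C) :
      ∀ᶠ t in 𝓝[≥] (0 : ℝ), f t ≤ C :=
    nhdsWithin_le_nhds ((hf.tendsto 0).eventually (ge_mem_nhds hC))
  have eventually_lt : ∀ᶠ t in 𝓝[≥] (0 : ℝ), t < T := nhdsWithin_le_nhds (gt_mem_nhds hT)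
  exact mem_nhdsGE_iff_exists_Icc_subset.1 (eventually_lt.and
    ((eventually_le (f := fun t => c + M * t) (by fun_prop) (by simpa using hcb)).and
      ((eventually_le (f := fun t => L * Real.exp (M * T) * t) (by fun_prop)
        (by simpa using hl)).and eventually_velocity_le)))

theorem not_isLeftInterface (h : IsStrongSolution ν A γ T M L ρ u ux) (hν : 0 < ν)
    (hA : 0 ≤ A * γ) (hT : 0 < T) {l : ℝ} : ¬ IsLeftInterface (ρ 0) (u 0) a b l := by
  intro hI
  have zero_mem : (0 : ℝ) ∈ Icc 0 T := ⟨le_rfl, hT.le⟩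
  have continuous_u₀ : Continuous (u 0) := (h.lipschitzWith 0 zero_mem).continuous
  obtain ⟨c, ⟨a_lt_c, c_lt_b⟩, u_c_neg⟩ : ∃ c ∈ Ioo a b, u 0 c < 0 :=
    nonempty_of_mem (inter_mem (Ioo_mem_nhdsLT hI.lt) (nhdsWithin_le_nhds
      ((continuous_u₀.tendsto b).eventually (gt_mem_nhds hI.velocity_neg))))
  obtain ⟨δ, δ_pos, u_c_lt⟩ : ∃ δ > 0, u 0 c < -δ := ⟨-u 0 c / 2, by linarith, by linarith⟩
  obtain ⟨τ, τ_pos, hτ⟩ := h.exists_short_time_bounds hT hI.rate_pos c_lt_b u_c_lt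
  have τ_mem : τ ∈ Ioo 0 T := ⟨τ_pos, (hτ τ ⟨τ_pos.le, le_rfl⟩).1⟩
  have ha := h.isTrajectory_interface hν.ne' hT.le hI.vacuum
  have u₀_nonpos (x : ℝ) (hx : x ∈ Icc a b) : u 0 x ≤ 0 := by
    rw [← closure_Ioo hI.lt.ne] at hx
    exact closure_minimal hI.velocity_nonpos (isClosed_le continuous_u₀ continuous_const) hx
  have interface {t : ℝ} (ht : t ∈ Ioc 0 τ) : u t a = 0 ∧ ux t a = 0 :=
    h.velocity_interface hν.ne' hI.vacuum ⟨ht.1, ht.2.trans_lt τ_mem.2⟩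
  refine (h.gradient_neg_of_velocity_nonpos hν hA a_lt_c τ_mem δ_pos (fun t ht x hx => ?_)
    (fun t ht => ?_) (fun x hx => u₀_nonpos x ⟨hx.1, hx.2.trans c_lt_b.le⟩) (fun t ht => ?_)
    (fun t ht => (hτ t ht).2.2.2) (interface ⟨τ_pos, le_rfl⟩).1).ne (interface ⟨τ_pos, le_rfl⟩).2
  · obtain ⟨t_lt, hcb, -⟩ := hτ t (Ioc_subset_Icc_self ht)
    exact h.density_pos_of_mem_Ioo ha hI.density_pos ⟨ht.1, t_lt⟩ hcb hx
  · obtain ⟨t_lt, hcb, hl, -⟩ := hτ t (Ioc_subset_Icc_self ht)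
    exact h.density_monotoneOn hI.rate_pos ha hI.density_pos hI.le_logDeriv ⟨ht.1, t_lt⟩ hcb hl
  · rcases ht.1.eq_or_lt with rfl | t_pos
    · exact u₀_nonpos a ⟨le_rfl, hI.lt.le⟩
    · exact (interface ⟨t_pos, ht.2⟩).1.le

lemma reflect (h : IsStrongSolution ν A γ T M L ρ u ux) :
    IsStrongSolution ν A γ T M L (fun t x => ρ t (-x)) (fun t x => -u t (-x))
      (fun t x => ux t (-x)) where
  continuousOn_velocity :=
    (h.continuousOn_velocity.comp (f := fun q : ℝ × ℝ => (q.1, -q.2)) (by fun_prop)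
      fun _ hq => ⟨hq.1, mem_univ _⟩).neg
  norm_velocity_le t ht x := (norm_neg _).trans_le (h.norm_velocity_le t ht (-x))
  lipschitzWith t ht :=
    ((h.lipschitzWith t ht).comp LipschitzWith.id.neg).neg.weaken (mul_one M).le
  continuousOn_density :=
    h.continuousOn_density.comp (f := fun q : ℝ × ℝ => (q.1, -q.2)) (by fun_prop)
      fun _ hq => ⟨hq.1, mem_univ _⟩
  hasDerivAt_velocity t ht x := by
    simpa using! ((h.hasDerivAt_velocity t ht (-x)).comp x (hasDerivAt_neg x)).neg
  transport Z t ht hZ := h.transport (fun s => -Z s) t ht (by simpa using! hZ.neg)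
  tendsto_velocity t ht := by
    simpa using ((h.tendsto_velocity t ht).comp
      (Homeomorph.neg ℝ).isClosedEmbedding.tendsto_cocompact).neg
  lipschitzWith_gradient t ht := by
    simpa using! (h.lipschitzWith_gradient t ht).comp LipschitzWith.id.neg
  momentum t ht x := by
    obtain ⟨ρx, ut, uxx, hρx, hut, huxx, momentum⟩ := h.momentum t ht (-x)
    refine ⟨-ρx, -ut, -uxx, ?_, hut.neg, ?_, ?_⟩
    · simpa using! hρx.comp x (hasDerivAt_neg x)
    · simpa using! huxx.comp x (hasDerivAt_neg x)
    · unfold momentumBalance at momentum ⊢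
      linarith

end IsStrongSolution

end StrongSolution

section TestFunctions

variable {f φ : ℝ → ℝ}

lemma integrable_mul_of_hasCompactSupport (hf : Continuous f) (hφ : Continuous φ)
    (hφc : HasCompactSupport φ) : Integrable fun x => f x * φ x :=
  (hf.mul hφ).integrable_of_hasCompactSupport hφc.mul_left

lemma integral_mul_deriv_eq_neg {f' : ℝ → ℝ} (hf : ∀ x, HasDerivAt f (f' x) x)
    (hf' : Continuous f') (hφ : ContDiff ℝ 1 φ) (hφc : HasCompactSupport φ) :
    ∫ x, f x * deriv φ x = -∫ x, f' x * φ x := by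
  have continuous_f : Continuous f := continuous_iff_continuousAt.2 fun x => (hf x).continuousAt
  exact integral_mul_deriv_eq_deriv_mul_of_integrable (fun x _ => hf x)
    (fun x _ => (hφ.differentiable one_ne_zero x).hasDerivAt)
    (integrable_mul_of_hasCompactSupport continuous_f (hφ.continuous_deriv le_rfl) hφc.deriv)
    (integrable_mul_of_hasCompactSupport hf' hφ.continuous hφc)
    (integrable_mul_of_hasCompactSupport continuous_f hφ.continuous hφc)

lemma eq_of_integral_mul_eq {g : ℝ → ℝ} (hf : Continuous f) (hg : Continuous g)
    (h : ∀ φ : ℝ → ℝ, ContDiff ℝ ∞ φ → HasCompactSupport φ →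
      ∫ x, f x * φ x = ∫ x, g x * φ x) : f = g := by
  refine (Continuous.ae_eq_iff_eq volume hf hg).1 (ae_eq_of_integral_contDiff_smul_eq
    hf.locallyIntegrable hg.locallyIntegrable fun φ hφ hφc => ?_)
  simpa only [smul_eq_mul, mul_comm (φ _)] using h φ hφ hφc

lemma integral_Iic_eq_zero_or_eq_integral {r x : ℝ} (hx : x ∉ Icc (-r) r)
    (hf : ∀ y, y ∉ Icc (-r) r → f y = 0) :
    ∫ y in Iic x, f y = 0 ∨ ∫ y in Iic x, f y = ∫ y, f y := by
  rcases lt_or_ge x (-r) with x_lt | le_x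
  · refine .inl (setIntegral_eq_zero_of_forall_eq_zero fun y hy => hf y fun hy' => ?_)
    exact (hy.trans_lt x_lt).not_ge hy'.1
  · refine .inr (setIntegral_eq_integral_of_forall_compl_eq_zero fun y hy => hf y fun hy' => ?_)
    exact hx ⟨le_x, (not_le.1 hy).le.trans hy'.2⟩

lemma exists_deriv_eq_of_integral_eq_zero (hf : ContDiff ℝ ∞ f) (hfc : HasCompactSupport f)
    (integral_eq_zero : ∫ x, f x = 0) :
    ∃ φ : ℝ → ℝ, ContDiff ℝ ∞ φ ∧ HasCompactSupport φ ∧ deriv φ = f := by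
  obtain ⟨r, support_subset⟩ := hfc.isCompact.isBounded.subset_closedBall 0
  have eq_zero (x : ℝ) (hx : x ∉ Icc (-r) r) : f x = 0 :=
    image_eq_zero_of_notMem_tsupport fun h => hx (by
      simpa only [Real.closedBall_eq_Icc, zero_sub, zero_add] using support_subset h)
  have integrable : Integrable f := hf.continuous.integrable_of_hasCompactSupport hfc
  have integral_Iic (x : ℝ) : ∫ y in Iic x, f y = (∫ y in Iic 0, f y) + ∫ y in (0 : ℝ)..x, f y := by
    rw [← intervalIntegral.integral_Iic_sub_Iic integrable.integrableOn integrable.integrableOn,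
      add_sub_cancel]
  have hasDerivAt (x : ℝ) : HasDerivAt (fun x => ∫ y in Iic x, f y) (f x) x := by
    rw [funext integral_Iic]
    exact (hf.continuous.integral_hasStrictDerivAt 0 x).hasDerivAt.const_add _
  have deriv_eq : deriv (fun x => ∫ y in Iic x, f y) = f := funext fun x => (hasDerivAt x).deriv
  refine ⟨fun x => ∫ y in Iic x, f y, ?_, ?_, deriv_eq⟩
  · rw [contDiff_infty_iff_deriv, deriv_eq]
    exact ⟨fun x => (hasDerivAt x).differentiableAt, hf⟩
  · refine HasCompactSupport.intro (isCompact_Icc (a := -r) (b := r)) fun x hx => ?_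
    simpa only [integral_eq_zero, or_self] using integral_Iic_eq_zero_or_eq_integral hx eq_zero

theorem exists_eq_const_of_integral_mul_deriv_eq_zero (hf : Continuous f)
    (h : ∀ φ : ℝ → ℝ, ContDiff ℝ ∞ φ → HasCompactSupport φ → ∫ x, f x * deriv φ x = 0) :
    ∃ C, ∀ x, f x = C := by
  let bump : ContDiffBump (0 : ℝ) := ⟨1, 2, one_pos, one_lt_two⟩
  let η : ℝ → ℝ := bump.normed volume
  have hη : ContDiff ℝ ∞ η := bump.contDiff_normed
  have hηc : HasCompactSupport η := bump.hasCompactSupport_normed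
  refine ⟨∫ x, f x * η x, congrFun (eq_of_integral_mul_eq hf continuous_const fun ψ hψ hψc => ?_)⟩
  obtain ⟨φ, hφ, hφc, deriv_φ⟩ : ∃ φ : ℝ → ℝ, ContDiff ℝ ∞ φ ∧ HasCompactSupport φ ∧
      deriv φ = fun x => ψ x - (∫ y, ψ y) * η x := by
    refine exists_deriv_eq_of_integral_eq_zero (hψ.sub (contDiff_const.mul hη))
      (hψc.sub hηc.mul_left) ?_
    rw [integral_sub (hψ.continuous.integrable_of_hasCompactSupport hψc)
      ((hη.continuous.integrable_of_hasCompactSupport hηc).const_mul _), integral_const_mul,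
      bump.integral_normed, mul_one, sub_self]
  have integral_mul_deriv := h φ hφ hφc
  simp_rw [deriv_φ, mul_sub, mul_left_comm _ (∫ y, ψ y)] at integral_mul_deriv
  rw [integral_sub (integrable_mul_of_hasCompactSupport hf hψ.continuous hψc)
    ((integrable_mul_of_hasCompactSupport hf hη.continuous hηc).const_mul _),
    integral_const_mul, sub_eq_zero] at integral_mul_deriv
  rw [integral_mul_deriv, integral_const_mul, mul_comm]

theorem hasDerivAt_of_integral_mul_eq_neg {f' : ℝ → ℝ} (hf : Continuous f) (hf' : Continuous f')
    (h : ∀ φ : ℝ → ℝ, ContDiff ℝ ∞ φ → HasCompactSupport φ →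
      ∫ x, f' x * φ x = -∫ x, f x * deriv φ x) (x : ℝ) : HasDerivAt f (f' x) x := by
  let primitive (x : ℝ) : ℝ := ∫ y in (0 : ℝ)..x, f' y
  have hasDerivAt_primitive (x : ℝ) : HasDerivAt primitive (f' x) x :=
    (hf'.integral_hasStrictDerivAt 0 x).hasDerivAt
  have continuous_primitive : Continuous primitive :=
    continuous_iff_continuousAt.2 fun x => (hasDerivAt_primitive x).continuousAt
  obtain ⟨C, sub_eq⟩ : ∃ C, ∀ x, f x - primitive x = C := by
    refine exists_eq_const_of_integral_mul_deriv_eq_zero (hf.sub continuous_primitive)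
      fun φ hφ hφc => ?_
    have continuous_deriv : Continuous (deriv φ) := hφ.continuous_deriv (by simp)
    simp_rw [sub_mul]
    rw [integral_sub (integrable_mul_of_hasCompactSupport hf continuous_deriv hφc.deriv)
      (integrable_mul_of_hasCompactSupport continuous_primitive continuous_deriv hφc.deriv),
      integral_mul_deriv_eq_neg hasDerivAt_primitive hf' (hφ.of_le (by simp)) hφc,
      h φ hφ hφc, neg_neg, sub_self]
  have f_eq : f = fun x => primitive x + C := funext fun x => by linarith [sub_eq x]
  exact f_eq ▸ (hasDerivAt_primitive x).add_const C

end TestFunctions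

section BoundedContinuousCurves

variable {X : Type*} [TopologicalSpace X]

section Integral

variable [MeasurableSpace X] [OpensMeasurableSpace X] {m : Measure X} {φ : X → ℝ}

lemma integrable_bcf_mul (hφ : Integrable φ m) (F : X →ᵇ ℝ) :
    Integrable (fun x => F x * φ x) m :=
  hφ.bdd_mul (map_continuous F).aestronglyMeasurable (.of_forall F.norm_coe_le_norm)

/-- The functional `F ↦ ∫ F φ` on bounded continuous functions, for an integrable weight `φ`. -/
def integralMulCLM (hφ : Integrable φ m) : (X →ᵇ ℝ) →L[ℝ] ℝ :=
  LinearMap.mkContinuous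
    { toFun F := ∫ x, F x * φ x ∂m
      map_add' F G := by
        simp only [BoundedContinuousFunction.add_apply, add_mul]
        exact integral_add (integrable_bcf_mul hφ F) (integrable_bcf_mul hφ G)
      map_smul' c F := by
        simp only [coe_smul, smul_eq_mul, mul_assoc, RingHom.id_apply, integral_const_mul] }
    (∫ x, ‖φ x‖ ∂m) fun F => by
      rw [mul_comm, ← integral_const_mul]
      refine norm_integral_le_of_norm_le (hφ.norm.const_mul _) (.of_forall fun x => ?_)
      rw [norm_mul]
      exact mul_le_mul_of_nonneg_right (F.norm_coe_le_norm x) (norm_nonneg _)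

lemma hasDerivAt_integral_mul {F : ℝ → X →ᵇ ℝ} {F' : X →ᵇ ℝ} {t : ℝ} (hF : HasDerivAt F F' t)
    (hφ : Integrable φ m) :
    HasDerivAt (fun s => ∫ x, F s x * φ x ∂m) (∫ x, F' x * φ x ∂m) t :=
  (integralMulCLM hφ).hasFDerivAt.comp_hasDerivAt t hF

end Integral

lemma hasDerivAt_eval_curve {F : ℝ → ℝ →ᵇ ℝ} {F' : ℝ →ᵇ ℝ} {Z : ℝ → ℝ} {t z fx : ℝ}
    (hF : HasDerivAt F F' t) (hZ : HasDerivAt Z z t) (hx : HasDerivAt (F t) fx (Z t)) :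
    HasDerivAt (fun s => F s (Z s)) (F' (Z t) + fx * z) t := by
  -- Evaluation is only continuous in the point, which suffices for the increment `F s - F t`.
  have increment : HasDerivAt (fun s => (F s - F t) (Z s)) (F' (Z t)) t := by
    rw [hasDerivAt_iff_tendsto_slope] at hF ⊢
    have slope_tendsto : Tendsto (fun s => (slope F t s, Z s)) (𝓝[≠] t) (𝓝 (F', Z t)) :=
      hF.prodMk_nhds (hZ.continuousAt.tendsto.mono_left nhdsWithin_le_nhds)
    refine ((continuous_eval.tendsto _).comp slope_tendsto).congr fun s => ?_
    simp [slope]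
  refine (increment.add (hx.comp t hZ)).congr_of_eventuallyEq (.of_forall fun s => ?_)
  simp

lemma continuousOn_uncurry_bcf {F : ℝ → X →ᵇ ℝ} {s : Set ℝ} (hF : ContinuousOn F s) :
    ContinuousOn (Function.uncurry fun t x => F t x) (s ×ˢ univ) :=
  continuous_eval.comp_continuousOn
    ((hF.comp continuousOn_fst fun _ hq => hq.1).prodMk continuousOn_snd)

end BoundedContinuousCurves

namespace IsC1Representative

variable {T t : ℝ} {f g : ℝ → ℝ → ℝ} {F Fx G Gx : ℝ → ℝ →ᵇ ℝ} {φ : ℝ → ℝ}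

lemma hasDerivAt_time (hF : IsC1Representative T f F Fx) (ht : t ∈ Ioo 0 T) :
    HasDerivAt F (deriv F t) t :=
  ((hF.contDiffOn.differentiableOn one_ne_zero).differentiableAt
    (Icc_mem_nhds ht.1 ht.2)).hasDerivAt

lemma apply_eq_of_ae_eq {f₀ : ℝ → ℝ} (hF : IsC1Representative T f F Fx) (ht : t ∈ Icc 0 T)
    (hf₀ : Continuous f₀) (h : f t =ᵐ[volume] f₀) : ⇑(F t) = f₀ :=
  (Continuous.ae_eq_iff_eq volume (map_continuous (F t)) hf₀).1 ((hF.ae_eq t ht).symm.trans h)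

lemma eventually_forall_abs_le (hF : IsC1Representative T f F Fx) (hT : 0 < T) :
    ∀ᶠ B : ℝ≥0 in atTop, (∀ t ∈ Icc 0 T, ∀ x, |F t x| ≤ B ∧ |Fx t x| ≤ B) ∧
      ∀ t ∈ Ioo 0 T, ∀ x, |deriv F t x| ≤ B := by
  have bound {H : ℝ → ℝ →ᵇ ℝ} (hH : ContinuousOn H (Icc 0 T)) :
      ∀ᶠ B : ℝ≥0 in atTop, ∀ t ∈ Icc 0 T, ∀ x, |H t x| ≤ B := by
    obtain ⟨C, hC⟩ := isCompact_Icc.exists_bound_of_continuousOn hH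
    filter_upwards [eventually_ge_atTop C.toNNReal] with B hB t ht x
    exact ((H t).norm_coe_le_norm x).trans ((hC t ht).trans (Real.toNNReal_le_iff_le_coe.1 hB))
  filter_upwards [bound hF.contDiffOn.continuousOn, bound hF.contDiffOn_gradient.continuousOn,
    bound (hF.contDiffOn.continuousOn_derivWithin (uniqueDiffOn_Icc hT) le_rfl)]
    with B hB hBx hBt
  refine ⟨fun t ht x => ⟨hB t ht x, hBx t ht x⟩, fun t ht x => ?_⟩
  rw [← derivWithin_of_mem_nhds (Icc_mem_nhds ht.1 ht.2)]
  exact hBt t (Ioo_subset_Icc_self ht) x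

lemma hasDerivAt_integral_mul (hF : IsC1Representative T f F Fx) (ht : t ∈ Ioo 0 T)
    (hφ : Integrable φ) :
    HasDerivAt (fun s => ∫ x, f s x * φ x) (∫ x, deriv F t x * φ x) t := by
  refine (IsentropicNS.hasDerivAt_integral_mul (hF.hasDerivAt_time ht) hφ).congr_of_eventuallyEq ?_
  filter_upwards [Icc_mem_nhds ht.1 ht.2] with s hs
  exact integral_congr_ae ((hF.ae_eq s hs).mul .rfl)

lemma hasDerivAt_integral_mul_mul (hF : IsC1Representative T f F Fx)
    (hG : IsC1Representative T g G Gx) (ht : t ∈ Ioo 0 T) (hφ : Integrable φ) :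
    HasDerivAt (fun s => ∫ x, f s x * g s x * φ x)
      (∫ x, (deriv F t x * G t x + F t x * deriv G t x) * φ x) t := by
  refine (IsentropicNS.hasDerivAt_integral_mul
    ((hF.hasDerivAt_time ht).mul (hG.hasDerivAt_time ht)) hφ).congr_of_eventuallyEq ?_
  filter_upwards [Icc_mem_nhds ht.1 ht.2] with s hs
  exact integral_congr_ae (((hF.ae_eq s hs).mul (hG.ae_eq s hs)).mul .rfl)

end IsC1Representative

section MomentumBalance

variable {A γ : ℝ}

lemma continuous_momentumBalance {X : Type*} [TopologicalSpace X] {r rx v vx vt : X → ℝ}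
    (hγ : 1 ≤ γ) (hr : Continuous r) (hrx : Continuous rx) (hv : Continuous v)
    (hvx : Continuous vx) (hvt : Continuous vt) :
    Continuous fun x => momentumBalance A γ (r x) (rx x) (v x) (vx x) (vt x) := by
  have continuous_rpow : Continuous fun x => r x ^ (γ - 1) :=
    hr.rpow_const fun _ => .inr (sub_nonneg.2 hγ)
  unfold momentumBalance
  fun_prop

lemma hasDerivAt_flux {r v : ℝ → ℝ} {rx vx x : ℝ} (hγ : 1 ≤ γ) (hr : HasDerivAt r rx x)
    (hv : HasDerivAt v vx x) (vt : ℝ) :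
    HasDerivAt (fun y => r y * v y ^ 2 + pressure A γ (r y))
      (momentumBalance A γ (r x) rx (v x) vx vt -
        (-(rx * v x + r x * vx) * v x + r x * vt)) x := by
  refine ((hr.mul (hv.pow 2)).add ((hr.rpow_const (.inr hγ)).const_mul A)).congr_deriv ?_
  simp only [momentumBalance, Pi.pow_apply]
  ring

lemma abs_momentumBalance_le {r rx v vx vt B : ℝ} (hA : 0 ≤ A * γ) (hγ : 1 ≤ γ) (hr : 0 ≤ r)
    (hrB : r ≤ B) (hrx : |rx| ≤ B) (hv : |v| ≤ B) (hvx : |vx| ≤ B) (hvt : |vt| ≤ B) :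
    |momentumBalance A γ r rx v vx vt| ≤ B * (B + B * B) + A * γ * B ^ (γ - 1) * B := by
  have hB : 0 ≤ B := hr.trans hrB
  have coeff_nonneg : 0 ≤ A * γ * r ^ (γ - 1) := mul_nonneg hA (Real.rpow_nonneg hr _)
  have rpow_le : r ^ (γ - 1) ≤ B ^ (γ - 1) := Real.rpow_le_rpow hr hrB (sub_nonneg.2 hγ)
  calc |momentumBalance A γ r rx v vx vt|
    _ ≤ |r * (vt + v * vx)| + |A * γ * r ^ (γ - 1) * rx| := abs_add_le _ _
    _ = r * |vt + v * vx| + A * γ * r ^ (γ - 1) * |rx| := by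
      rw [abs_mul, abs_mul _ rx, abs_of_nonneg hr, abs_of_nonneg coeff_nonneg]
    _ ≤ r * (|vt| + |v| * |vx|) + A * γ * r ^ (γ - 1) * |rx| := by
      rw [← abs_mul]
      gcongr
      exact abs_add_le _ _
    _ ≤ B * (B + B * B) + A * γ * B ^ (γ - 1) * B := by gcongr

end MomentumBalance

namespace IsSolution

variable {μ lam A γ m T t : ℝ} {ρ₀ u₀ φ : ℝ → ℝ} {ρ u : ℝ → ℝ → ℝ} {R Rx U Ux : ℝ → ℝ →ᵇ ℝ}

lemma deriv_density_eq (h : IsSolution μ lam A γ m T ρ₀ u₀ ρ u) (hR : IsC1Representative T ρ R Rx)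
    (hU : IsC1Representative T u U Ux) (ht : t ∈ Ioo 0 T) (x : ℝ) :
    deriv R t x = -(Rx t x * U t x + R t x * Ux t x) := by
  have ht' := Ioo_subset_Icc_self ht
  refine congrFun (eq_of_integral_mul_eq (g := fun x => -(Rx t x * U t x + R t x * Ux t x))
    (map_continuous (deriv R t)) (by fun_prop) fun φ hφ hφc => ?_) x
  calc ∫ x, deriv R t x * φ x
    _ = ∫ x, ρ t x * u t x * deriv φ x :=
      (hR.hasDerivAt_integral_mul ht (hφ.continuous.integrable_of_hasCompactSupport hφc)).unique
        (h.continuity_eq φ hφ hφc t ht)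
    _ = ∫ x, R t x * U t x * deriv φ x :=
      integral_congr_ae (((hR.ae_eq t ht').mul (hU.ae_eq t ht')).mul .rfl)
    _ = -∫ x, (Rx t x * U t x + R t x * Ux t x) * φ x :=
      integral_mul_deriv_eq_neg (fun x => (hR.hasDerivAt t ht' x).mul (hU.hasDerivAt t ht' x))
        (by fun_prop) (hφ.of_le (by simp)) hφc
    _ = ∫ x, -(Rx t x * U t x + R t x * Ux t x) * φ x := by simp only [neg_mul, integral_neg]

lemma integral_momentum_eq (h : IsSolution μ lam A γ m T ρ₀ u₀ ρ u)
    (hR : IsC1Representative T ρ R Rx) (hU : IsC1Representative T u U Ux) (ht : t ∈ Ioo 0 T)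
    (hφ : ContDiff ℝ ∞ φ) (hφc : HasCompactSupport φ) :
    ∫ x, (deriv R t x * U t x + R t x * deriv U t x) * φ x =
      (∫ x, (R t x * U t x ^ 2 + pressure A γ (R t x)) * deriv φ x)
        + (μ + (μ + lam)) * ∫ x, U t x * deriv (deriv φ) x := by
  have hRt := hR.ae_eq t (Ioo_subset_Icc_self ht)
  have hUt := hU.ae_eq t (Ioo_subset_Icc_self ht)
  have flux : ∫ x, (ρ t x * u t x ^ 2 + pressure A γ (ρ t x)) * deriv φ x =
      ∫ x, (R t x * U t x ^ 2 + pressure A γ (R t x)) * deriv φ x := by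
    refine integral_congr_ae ?_
    filter_upwards [hRt, hUt] with x hRx hUx
    rw [hRx, hUx]
  have viscosity : ∫ x, u t x * deriv (deriv φ) x = ∫ x, U t x * deriv (deriv φ) x :=
    integral_congr_ae (hUt.mul .rfl)
  rw [(hR.hasDerivAt_integral_mul_mul hU ht
    (hφ.continuous.integrable_of_hasCompactSupport hφc)).unique (h.momentum_eq φ hφ hφc t ht), flux,
    viscosity]

lemma integral_momentumBalance_mul (h : IsSolution μ lam A γ m T ρ₀ u₀ ρ u) (hγ : 1 ≤ γ)
    (hR : IsC1Representative T ρ R Rx) (hU : IsC1Representative T u U Ux) (ht : t ∈ Ioo 0 T)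
    (hφ : ContDiff ℝ ∞ φ) (hφc : HasCompactSupport φ) :
    ∫ x, momentumBalance A γ (R t x) (Rx t x) (U t x) (Ux t x) (deriv U t x) * φ x =
      -∫ x, (μ + (μ + lam)) * Ux t x * deriv φ x := by
  have ht' := Ioo_subset_Icc_self ht
  have hdφ : ContDiff ℝ ∞ (deriv φ) := (contDiff_infty_iff_deriv.1 hφ).2
  have continuous_balance : Continuous fun x =>
      momentumBalance A γ (R t x) (Rx t x) (U t x) (Ux t x) (deriv U t x) :=
    continuous_momentumBalance hγ (by fun_prop) (by fun_prop) (by fun_prop) (by fun_prop)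
      (by fun_prop)
  have continuous_momentum_deriv : Continuous fun x =>
      deriv R t x * U t x + R t x * deriv U t x := by fun_prop
  have flux_deriv (x : ℝ) : HasDerivAt (fun x => R t x * U t x ^ 2 + pressure A γ (R t x))
      (momentumBalance A γ (R t x) (Rx t x) (U t x) (Ux t x) (deriv U t x) -
        (deriv R t x * U t x + R t x * deriv U t x)) x := by
    rw [h.deriv_density_eq hR hU ht]
    exact hasDerivAt_flux hγ (hR.hasDerivAt t ht' x) (hU.hasDerivAt t ht' x) _
  have weak := h.integral_momentum_eq hR hU ht hφ hφc
  rw [integral_mul_deriv_eq_neg flux_deriv (continuous_balance.sub continuous_momentum_deriv)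
      (hφ.of_le (by simp)) hφc,
    integral_mul_deriv_eq_neg (hU.hasDerivAt t ht') (map_continuous (Ux t)) (hdφ.of_le (by simp))
      hφc.deriv] at weak
  simp_rw [sub_mul] at weak
  rw [integral_sub (integrable_mul_of_hasCompactSupport continuous_balance hφ.continuous hφc)
    (integrable_mul_of_hasCompactSupport continuous_momentum_deriv hφ.continuous hφc)] at weak
  simp_rw [mul_assoc, integral_const_mul]
  linarith

lemma hasDerivAt_gradient (h : IsSolution μ lam A γ m T ρ₀ u₀ ρ u) (hγ : 1 ≤ γ)
    (hν : μ + (μ + lam) ≠ 0) (hR : IsC1Representative T ρ R Rx) (hU : IsC1Representative T u U Ux)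
    (ht : t ∈ Ioo 0 T) (x : ℝ) :
    HasDerivAt (Ux t) (momentumBalance A γ (R t x) (Rx t x) (U t x) (Ux t x) (deriv U t x) /
      (μ + (μ + lam))) x := by
  have hasDerivAt_stress : HasDerivAt (fun y => (μ + (μ + lam)) * Ux t y)
      (momentumBalance A γ (R t x) (Rx t x) (U t x) (Ux t x) (deriv U t x)) x :=
    hasDerivAt_of_integral_mul_eq_neg (by fun_prop)
      (continuous_momentumBalance hγ (by fun_prop) (by fun_prop) (by fun_prop) (by fun_prop)
        (by fun_prop)) (fun φ => h.integral_momentumBalance_mul hγ hR hU ht) x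
  simpa only [mul_div_cancel_left₀ _ hν] using hasDerivAt_stress.div_const (μ + (μ + lam))

lemma isTransported {M : ℝ≥0} (h : IsSolution μ lam A γ m T ρ₀ u₀ ρ u)
    (hR : IsC1Representative T ρ R Rx) (hU : IsC1Representative T u U Ux)
    (hM : ∀ t ∈ Icc 0 T, ∀ x, |U t x| ≤ M ∧ |Ux t x| ≤ M) :
    IsTransported T M (fun t x => R t x) (fun t x => U t x) (fun t x => Ux t x) where
  continuousOn_velocity := continuousOn_uncurry_bcf hU.contDiffOn.continuousOn
  norm_velocity_le t ht x := (hM t ht x).1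
  lipschitzWith t ht :=
    lipschitzWith_of_nnnorm_deriv_le (fun x => (hU.hasDerivAt t ht x).differentiableAt) fun x => by
      rw [(hU.hasDerivAt t ht x).deriv]
      exact (hM t ht x).2
  continuousOn_density := continuousOn_uncurry_bcf hR.contDiffOn.continuousOn
  hasDerivAt_velocity := hU.hasDerivAt
  transport Z t ht hZ := by
    refine (hasDerivAt_eval_curve (hR.hasDerivAt_time ht) hZ
      (hR.hasDerivAt t (Ioo_subset_Icc_self ht) (Z t))).congr_deriv ?_
    rw [h.deriv_density_eq hR hU ht]
    ring

theorem exists_isStrongSolution (h : IsSolution μ lam A γ m T ρ₀ u₀ ρ u) (hm : 3 / 2 < m)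
    (hA : 0 ≤ A) (hγ : 1 ≤ γ) (hν : 0 < μ + (μ + lam)) (hT : 0 < T) (hρ₀ : Continuous ρ₀)
    (hu₀ : Continuous u₀) (ρ₀_nonneg : ∀ x, 0 ≤ ρ₀ x) :
    ∃ (M L : ℝ≥0) (ρ' u' ux' : ℝ → ℝ → ℝ),
      IsStrongSolution (μ + (μ + lam)) A γ T M L ρ' u' ux' ∧ ρ' 0 = ρ₀ ∧ u' 0 = u₀ := by
  obtain ⟨R, Rx, hR⟩ := h.density_mem.exists_isC1Representative hm
  obtain ⟨U, Ux, hU⟩ := h.velocity_mem.exists_isC1Representative hm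
  obtain ⟨B, ⟨R_le, -⟩, U_le, Ut_le⟩ :=
    ((hR.eventually_forall_abs_le hT).and (hU.eventually_forall_abs_le hT)).exists
  have zero_mem : (0 : ℝ) ∈ Icc 0 T := ⟨le_rfl, hT.le⟩
  have R_zero : ⇑(R 0) = ρ₀ := hR.apply_eq_of_ae_eq zero_mem hρ₀ h.density_init
  have U_zero : ⇑(U 0) = u₀ := hU.apply_eq_of_ae_eq zero_mem hu₀ h.velocity_init
  have transported := h.isTransported hR hU U_le
  let L : ℝ := (B * (B + B * B) + A * γ * B ^ (γ - 1) * B) / (μ + (μ + lam))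
  refine ⟨B, L.toNNReal, _, _, _,
    { toIsTransported := transported
      tendsto_velocity := hU.tendsto_cocompact
      lipschitzWith_gradient := fun t ht => ?_
      momentum := fun t ht x => ?_ }, R_zero, U_zero⟩
  · have hasDerivAt := h.hasDerivAt_gradient hγ hν.ne' hR hU ht
    refine lipschitzWith_of_nnnorm_deriv_le (fun x => (hasDerivAt x).differentiableAt) fun x => ?_
    have ht' := Ioo_subset_Icc_self ht
    have R_nonneg : 0 ≤ R t x := transported.density_nonneg (by simpa only [R_zero]) ht' x
    rw [(hasDerivAt x).deriv, ← NNReal.coe_le_coe, coe_nnnorm, Real.norm_eq_abs, abs_div,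
      abs_of_pos hν]
    refine le_trans ?_ (Real.le_coe_toNNReal L)
    exact div_le_div_of_nonneg_right (abs_momentumBalance_le (by positivity) hγ R_nonneg
      ((le_abs_self _).trans (R_le t ht' x).1) (R_le t ht' x).2 (U_le t ht' x).1 (U_le t ht' x).2
      (Ut_le t ht x)) hν.le
  · refine ⟨Rx t x, deriv U t x, _, hR.hasDerivAt t (Ioo_subset_Icc_self ht) x, ?_,
      h.hasDerivAt_gradient hγ hν.ne' hR hU ht x, (mul_div_cancel₀ _ hν.ne').symm⟩
    simpa using hasDerivAt_eval_curve (hU.hasDerivAt_time ht) (hasDerivAt_const t x)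
      (hU.hasDerivAt t (Ioo_subset_Icc_self ht) x)

end IsSolution

section InitialData

variable {ρ₀ u₀ : ℝ → ℝ} {a b : ℝ}

lemma nonneg_of_tsupport_eq_Icc (hρ₀ : Continuous ρ₀) (hab : a ≠ b)
    (hsupp : tsupport ρ₀ = Icc a b) (hpos : ∀ x ∈ Ioo a b, 0 < ρ₀ x) (x : ℝ) : 0 ≤ ρ₀ x := by
  by_cases hx : x ∈ tsupport ρ₀
  · rw [hsupp, ← closure_Ioo hab] at hx
    exact closure_minimal (fun y hy => (hpos y hy).le) (isClosed_le continuous_const hρ₀) hx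
  · exact (image_eq_zero_of_notMem_tsupport hx).ge

lemma LeftCondition.exists_isLeftInterface (h : LeftCondition ρ₀ u₀)
    (hsupp : tsupport ρ₀ = Icc 0 1) (hpos : ∀ x ∈ Ioo (0 : ℝ) 1, 0 < ρ₀ x) :
    ∃ a b l, IsLeftInterface ρ₀ u₀ a b l := by
  obtain ⟨l₁, l₃, l₁_pos, l₃_pos, l₃_lt, le_logDeriv, velocity_neg, velocity_nonpos⟩ := h
  exact ⟨0, l₃, l₁,
    { lt := l₃_pos
      rate_pos := l₁_pos
      vacuum := fun x hx =>
        image_eq_zero_of_notMem_tsupport fun hx' => hx.not_ge (hsupp ▸ hx' : x ∈ Icc 0 1).1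
      density_pos := fun x hx => hpos x ⟨hx.1, hx.2.trans l₃_lt⟩
      le_logDeriv := le_logDeriv
      velocity_nonpos := velocity_nonpos
      velocity_neg := velocity_neg }⟩

lemma RightCondition.exists_isLeftInterface_reflect (h : RightCondition ρ₀ u₀)
    (hsupp : tsupport ρ₀ = Icc 0 1) (hpos : ∀ x ∈ Ioo (0 : ℝ) 1, 0 < ρ₀ x) :
    ∃ a b l, IsLeftInterface (fun x => ρ₀ (-x)) (fun x => -u₀ (-x)) a b l := by
  obtain ⟨l₂, l₄, l₂_pos, l₄_pos, l₄_lt, logDeriv_le, velocity_pos, velocity_nonneg⟩ := h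
  have neg_mem {x : ℝ} (hx : x ∈ Ioo (-1) (-l₄)) : -x ∈ Ioo l₄ 1 :=
    ⟨lt_neg_of_lt_neg hx.2, neg_lt_of_neg_lt hx.1⟩
  refine ⟨-1, -l₄, l₂,
    { lt := neg_lt_neg l₄_lt
      rate_pos := l₂_pos
      vacuum := fun x hx => image_eq_zero_of_notMem_tsupport fun hx' =>
        (lt_neg_of_lt_neg hx).not_ge (hsupp ▸ hx' : -x ∈ Icc 0 1).2
      density_pos := fun x hx => hpos (-x) ⟨l₄_pos.trans (neg_mem hx).1, (neg_mem hx).2⟩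
      le_logDeriv := fun x hx => ?_
      velocity_nonpos := fun x hx => neg_nonpos.2 (velocity_nonneg (-x) (neg_mem hx))
      velocity_neg := by simpa only [neg_neg, neg_lt_zero] }⟩
  rw [deriv_comp_neg, neg_div]
  exact le_neg_of_le_neg (logDeriv_le (-x) (neg_mem hx))

end InitialData

end

end IsentropicNS

theorem theorem1p1_general (μ lam A γ m T : ℝ) (hν : 0 < 2 * μ + lam) (hA : 0 ≤ A) (hγ : 1 ≤ γ)
    (hm : 3 / 2 < m) (hT : 0 < T) (ρ₀ u₀ : ℝ → ℝ) (hρ₀ : Continuous ρ₀) (hu₀ : Continuous u₀)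
    (hρ₀_nonneg : ∀ x, 0 ≤ ρ₀ x)
    (hinterface : (∃ a b l, IsentropicNS.IsLeftInterface ρ₀ u₀ a b l) ∨
      ∃ a b l, IsentropicNS.IsLeftInterface (fun x => ρ₀ (-x)) (fun x => -u₀ (-x)) a b l) :
    ¬ ∃ ρ u : ℝ → ℝ → ℝ, IsentropicNS.IsSolution μ lam A γ m T ρ₀ u₀ ρ u := by
  rintro ⟨ρ, u, solution⟩
  have hν' : 0 < μ + (μ + lam) := by linarith
  have hAγ : 0 ≤ A * γ := by positivity
  obtain ⟨M, L, ρ', u', ux', strong, rfl, rfl⟩ :=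
    solution.exists_isStrongSolution hm hA hγ hν' hT hρ₀ hu₀ hρ₀_nonneg
  rcases hinterface with ⟨a, b, l, left⟩ | ⟨a, b, l, right⟩
  · exact strong.not_isLeftInterface hν' hAγ hT left
  · exact strong.reflect.not_isLeftInterface hν' hAγ hT right

theorem theorem1p1 (μ lam A γ m : ℝ) (hμ : 0 < μ) (hlam : 0 < 2 * μ + lam) (hA : 0 < A)
    (hγ : 1 < γ) (hm : 2 < m) (ρ₀ u₀ : ℝ → ℝ) (hρ₀ : Continuous ρ₀) (hu₀ : Continuous u₀)
    (hsupp : tsupport ρ₀ = Set.Icc 0 1) (hpos : ∀ x ∈ Set.Ioo (0 : ℝ) 1, 0 < ρ₀ x)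
    (hcond : IsentropicNS.LeftCondition ρ₀ u₀ ∨ IsentropicNS.RightCondition ρ₀ u₀)
    (T : ℝ) (hT : 0 < T) :
    ¬ ∃ ρ u : ℝ → ℝ → ℝ, IsentropicNS.IsSolution μ lam A γ m T ρ₀ u₀ ρ u :=
  theorem1p1_general μ lam A γ m T hlam hA.le hγ.le (by linarith) hT ρ₀ u₀ hρ₀ hu₀
    (IsentropicNS.nonneg_of_tsupport_eq_Icc hρ₀ zero_ne_one hsupp hpos)
    (hcond.imp (·.exists_isLeftInterface hsupp hpos)
      (·.exists_isLeftInterface_reflect hsupp hpos))
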